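/- Let $G$ be a finite-dimensional real Lie group with identity $e$, $H\subseteq G$ a closed subgroup, and $\pi:G\to G/H$ the projection, where $G/H$ carries the smooth manifold structure on the quotient space for which $\pi$ is a smooth submersion. Let $L_g$ denote left multiplication by $g$, let $\mathrm{ad}_g:T_eG\to T_eG$ be the differential at $e$ of $x\mapsto gxg^{-1}$, and assume that $T_eG=T_eH\oplus M$ for a linear subspace $M$ with $\mathrm{ad}_h(M)\subseteq M$ for all $h\in H$. Let $G\times_{\mathrm{ad}_H}M$ be the quotient of $G\times M$ by $(g,X)\sim(gh,\mathrm{ad}_{h^{-1}}X)$, $h\in H$, with the quotient topology, and for $g\in G$ put $\mathfrak m_g=(L_g)_*M\subseteq T_gG$. Then: 1. $G\times_{\mathrm{ad}_H}M$ has a smooth manifold structure for which $G\times M\to G\times_{\mathrm{ad}_H}M$ is a smooth submersion, and with this structure there is a well-defined diffeomorphism $$G\times_{\mathrm{ad}_H}M\to T(G/H),\qquad [g,X]\mapsto \pi_*(L_g)_*X,$$ covering the identity of $G/H$ and restricting to a linear isomorphism on each fibre (that is, an isomorphism of vector bundles over $G/H$). 2. The distribution $\mathfrak m$ is a connection on the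 principal $H$-bundle $\pi:G\to G/H$: it is smooth, complementary to $\ker\pi_*$, and invariant under right multiplication by $H$. Through the isomorphism in 1 it induces a canonical smooth connection $\nabla$ on $T(G/H)$: there is a smooth $\nabla$, unique on differentiable vector fields, such that for every vector field $\sigma$ on $G/H$, written as $\sigma(\pi(g))=\pi_*(L_g)_*f(g)$ with $f:G\to M$, for every $g$ such that $\sigma$ is differentiable at $\pi(g)$, and for every $w\in\mathfrak m_g$, one has $\nabla_{\pi_*w}\sigma=\pi_*(L_g)_*\big(df_g(w)\big)$. 3. Let $J\subseteq\mathbb R$ be an open interval and $c$ a curve in $G/H$ defined on $J$. Then $c$ is a geodesic of $\nabla$ if and only if $c(t)=\pi(g_t)$ on $J$ for a horizontal curve $g_t$ in $G$ (that is, $\dot g_t\in\mathfrak m_{g_t}$) satisfying $$\frac{d}{dt}g_t=(L_{g_t})_*X$$ for some fixed $X\in M$. 4. There is a smooth canonical left-invariant connection on $TG$, i.e. the one that differentiates a vector field $g\mapsto(L_g)_*f(g)$, $f:G\to T_eG$, as $\nabla^G_w\big((L_g)_*f\big)=(L_g)_*(df_g(w))$. For $J$, $c$ as in 3 and every $t_0\in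 J$, $c$ is a geodesic of $\nabla$ if and only if $c=\pi(g_t)$ on $J$ for a geodesic $g_t$ of $\nabla^G$ on $J$ with $\dot g_{t_0}\in\mathfrak m_{g_{t_0}}$. -/

import Mathlib

open scoped Manifold ContDiff Bundle Topology

noncomputable section

namespace Homogeneous

/-! ### The adjoint action and the tangent space of a closed subgroup -/

section Group

variable {E : Type*} [NormedAddCommGroup E] [NormedSpace ℝ E]
  {G : Type*} [TopologicalSpace G] [ChartedSpace E G] [Group G]

/-- The adjoint action of `g` on `T_e G`: the differential at `e` of `x ↦ g x g⁻¹`. -/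
def Ad (g : G) : GroupLieAlgebra 𝓘(ℝ, E) G →L[ℝ] GroupLieAlgebra 𝓘(ℝ, E) G :=
  (mfderiv 𝓘(ℝ, E) 𝓘(ℝ, E) (fun x : G => g * x * g⁻¹) 1 : E →L[ℝ] E)

lemma Ad_one : Ad (E := E) (1 : G) = ContinuousLinearMap.id ℝ _ := by
  have h : (fun x : G => 1 * x * (1 : G)⁻¹) = id := by ext x; simp
  unfold Ad
  rw [h]
  exact mfderiv_id

lemma contMDiff_conj [LieGroup 𝓘(ℝ, E) ∞ G] (g : G) :
    ContMDiff 𝓘(ℝ, E) 𝓘(ℝ, E) ∞ (fun x : G => g * x * g⁻¹) :=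
  (contMDiff_mul_right (I := 𝓘(ℝ, E)) (a := g⁻¹)).comp (contMDiff_mul_left (a := g))

lemma Ad_mul [LieGroup 𝓘(ℝ, E) ∞ G] (g h : G) :
    Ad (E := E) (g * h) = (Ad (E := E) g).comp (Ad (E := E) h) := by
  have hc : (fun x : G => g * h * x * (g * h)⁻¹) =
      (fun x : G => g * x * g⁻¹) ∘ (fun x : G => h * x * h⁻¹) := by
    ext x; simp [mul_assoc]
  have key := mfderiv_comp (I := 𝓘(ℝ, E)) (I' := 𝓘(ℝ, E)) (I'' := 𝓘(ℝ, E)) (1 : G)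
    ((contMDiff_conj (E := E) g).mdifferentiableAt (by simp))
    ((contMDiff_conj (E := E) h).mdifferentiableAt (by simp))
  rw [← hc] at key
  have hp : ∀ y : G, y = 1 →
      (mfderiv 𝓘(ℝ, E) 𝓘(ℝ, E) (fun x : G => g * x * g⁻¹) y : E →L[ℝ] E) =
      (mfderiv 𝓘(ℝ, E) 𝓘(ℝ, E) (fun x : G => g * x * g⁻¹) 1 : E →L[ℝ] E) := by
    rintro y rfl; rfl
  have h1 := hp (h * 1 * h⁻¹) (by simp)
  unfold Ad
  refine Eq.trans key ?_
  exact congrArg (fun A : E →L[ℝ] E => A.comp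
    (mfderiv 𝓘(ℝ, E) 𝓘(ℝ, E) (fun x : G => h * x * h⁻¹) 1 : E →L[ℝ] E)) h1

/-- The differential `(L_g)_* : T_e G → T_g G` of left multiplication by `g`. -/
def dL (g : G) : GroupLieAlgebra 𝓘(ℝ, E) G →L[ℝ] TangentSpace 𝓘(ℝ, E) g :=
  (mfderiv 𝓘(ℝ, E) 𝓘(ℝ, E) (fun x : G => g * x) 1 : E →L[ℝ] E)

lemma dL_apply (g : G) (X : GroupLieAlgebra 𝓘(ℝ, E) G) :
    dL g X = mulInvariantVectorField X g := rfl

/-- The tangent space `T_e H` of a (closed) subgroup `H` of `G`: the velocities at `0` of smooth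
curves in `G` which start at `e` and stay in `H`. -/
def tangentAtOne [LieGroup 𝓘(ℝ, E) ∞ G] (H : Subgroup G) :
    Submodule ℝ (GroupLieAlgebra 𝓘(ℝ, E) G) where
  carrier := {X | ∃ γ : ℝ → G, ContMDiff 𝓘(ℝ, ℝ) 𝓘(ℝ, E) ∞ γ ∧ (∀ t, γ t ∈ H) ∧
    γ 0 = 1 ∧ HasMFDerivAt 𝓘(ℝ, ℝ) 𝓘(ℝ, E) γ 0
      (ContinuousLinearMap.toSpanSingleton ℝ (X : E) : ℝ →L[ℝ] E)}
  zero_mem' := by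
    refine ⟨fun _ => 1, contMDiff_const, fun _ => H.one_mem, rfl, ?_⟩
    have h := hasMFDerivAt_const (I := 𝓘(ℝ, ℝ)) (I' := 𝓘(ℝ, E)) (1 : G) (0 : ℝ)
    have h0 : (ContinuousLinearMap.toSpanSingleton ℝ (0 : E) : ℝ →L[ℝ] E) = 0 := by
      ext; simp
    exact h0 ▸ h
  add_mem' := by
    rintro X Y ⟨γ, hγ, hγH, hγ0, hγ'⟩ ⟨δ, hδ, hδH, hδ0, hδ'⟩
    refine ⟨fun t => γ t * δ t, hγ.mul hδ, fun t => H.mul_mem (hγH t) (hδH t), by simp [hγ0, hδ0],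
      ?_⟩
    have hmul : MDifferentiableAt (𝓘(ℝ, E).prod 𝓘(ℝ, E)) 𝓘(ℝ, E)
        (fun p : G × G => p.1 * p.2) (γ 0, δ 0) :=
      (contMDiff_mul 𝓘(ℝ, E) ∞).mdifferentiableAt (by simp)
    have hcomp := HasMFDerivAt.comp (0 : ℝ) hmul.hasMFDerivAt (hγ'.prodMk hδ')
    have hL : ∀ a b : G, a = 1 → b = 1 →
        (mfderiv 𝓘(ℝ, E) 𝓘(ℝ, E) (fun z : G => z * b) a : E →L[ℝ] E) =
          ContinuousLinearMap.id ℝ E := by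
      rintro _ _ rfl rfl
      have h : (fun z : G => z * (1 : G)) = id := by ext z; simp
      rw [h]; exact mfderiv_id
    have hR : ∀ a b : G, a = 1 → b = 1 →
        (mfderiv 𝓘(ℝ, E) 𝓘(ℝ, E) (fun z : G => a * z) b : E →L[ℝ] E) =
          ContinuousLinearMap.id ℝ E := by
      rintro _ _ rfl rfl
      have h : (fun z : G => (1 : G) * z) = id := by ext z; simp
      rw [h]; exact mfderiv_id
    refine hcomp.congr_mfderiv ?_
    refine ContinuousLinearMap.ext fun t => ?_
    refine Eq.trans (mfderiv_prod_eq_add_apply hmul) ?_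
    let r : ℝ := t
    exact (congrArg₂ (fun a b : E => a + b)
      (congrArg (fun A : E →L[ℝ] E => A (r • (X : E))) (hL _ _ hγ0 hδ0))
      (congrArg (fun A : E →L[ℝ] E => A (r • (Y : E))) (hR _ _ hγ0 hδ0))).trans
      (smul_add r (X : E) (Y : E)).symm
  smul_mem' := by
    rintro c X ⟨γ, hγ, hγH, hγ0, hγ'⟩
    have hm : HasMFDerivAt 𝓘(ℝ, ℝ) 𝓘(ℝ, ℝ) (fun t : ℝ => c * t) 0
        (ContinuousLinearMap.toSpanSingleton ℝ c : ℝ →L[ℝ] ℝ) := by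
      have h := ((hasDerivAt_id (0 : ℝ)).const_mul c).hasFDerivAt
      rw [mul_one] at h
      exact h.hasMFDerivAt
    have hms : ContMDiff 𝓘(ℝ, ℝ) 𝓘(ℝ, ℝ) ∞ (fun t : ℝ => c * t) :=
      (contDiff_const.mul contDiff_id).contMDiff
    refine ⟨fun t => γ (c * t), hγ.comp hms, fun t => hγH _, by simpa using hγ0, ?_⟩
    have hγ2 : HasMFDerivAt 𝓘(ℝ, ℝ) 𝓘(ℝ, E) γ (c * 0)
      (ContinuousLinearMap.toSpanSingleton ℝ (X : E) : ℝ →L[ℝ] E) := by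
      have : ∀ s : ℝ, s = 0 → HasMFDerivAt 𝓘(ℝ, ℝ) 𝓘(ℝ, E) γ s
          (ContinuousLinearMap.toSpanSingleton ℝ (X : E) : ℝ →L[ℝ] E) := by
        rintro s rfl; exact hγ'
      exact this _ (by simp)
    have hlin : (ContinuousLinearMap.toSpanSingleton ℝ (X : E) : ℝ →L[ℝ] E).comp
        (ContinuousLinearMap.toSpanSingleton ℝ c : ℝ →L[ℝ] ℝ) =
        ContinuousLinearMap.toSpanSingleton ℝ ((c • X : GroupLieAlgebra 𝓘(ℝ, E) G) : E) := by
      refine ContinuousLinearMap.ext fun t => ?_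
      change (t • c) • (X : E) = t • (c • (X : E))
      rw [smul_assoc]
    exact hlin ▸ HasMFDerivAt.comp (0 : ℝ) hγ2 hm

end Group

/-! ### The associated bundle `G ×_{Ad_H} M` -/

section Associated

variable {E : Type*} [NormedAddCommGroup E] [NormedSpace ℝ E]
  {G : Type*} [TopologicalSpace G] [ChartedSpace E G] [Group G] [LieGroup 𝓘(ℝ, E) ∞ G]

/-- An `Ad_H`-invariant linear complement `M` of `T_e H` in `T_e G`. -/
structure InvariantComplement (H : Subgroup G) where
  /-- The underlying linear subspace of `T_e G`. -/
  space : Submodule ℝ (GroupLieAlgebra 𝓘(ℝ, E) G)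
  isCompl : IsCompl (tangentAtOne H) space
  ad_mem : ∀ h ∈ H, ∀ X ∈ space, Ad h X ∈ space

variable {H : Subgroup G}

/-- The subspace `M`, regarded as a subspace of the normed space `E` on which `G` is modelled (in
Mathlib `T_e G` is a type synonym of `E` without a norm). -/
abbrev InvariantComplement.normed (M : InvariantComplement (E := E) H) : Submodule ℝ E := M.space

/-- The inclusion of `M` in `T_e G`. -/
def InvariantComplement.incl (M : InvariantComplement (E := E) H) :
    M.normed →L[ℝ] GroupLieAlgebra 𝓘(ℝ, E) G := (M.normed.subtypeL : M.normed →L[ℝ] E)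

lemma InvariantComplement.incl_injective (M : InvariantComplement (E := E) H) :
    Function.Injective M.incl := fun _ _ h => Subtype.ext h

/-- The restriction of `Ad h` to `M`, for `h ∈ H`. -/
def InvariantComplement.ad (M : InvariantComplement (E := E) H) (h : H) :
    M.normed →ₗ[ℝ] M.normed :=
  { toFun := fun X => ⟨Ad (h : G) (M.incl X), M.ad_mem h h.2 _ X.2⟩
    map_add' := fun X Y => M.incl_injective (map_add (Ad (h : G)) (M.incl X) (M.incl Y))
    map_smul' := fun c X => M.incl_injective (map_smul (Ad (h : G)) c (M.incl X)) }

lemma InvariantComplement.incl_ad (M : InvariantComplement (E := E) H) (h : H) (X : M.normed) :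
    M.incl (M.ad h X) = Ad (h : G) (M.incl X) := rfl

lemma InvariantComplement.ad_one (M : InvariantComplement (E := E) H) (X : M.normed) :
    M.ad 1 X = X := by
  apply M.incl_injective
  rw [M.incl_ad]
  exact congrArg (fun A => A (M.incl X)) (Ad_one (E := E) (G := G))

lemma InvariantComplement.ad_mul (M : InvariantComplement (E := E) H) (h k : H) (X : M.normed) :
    M.ad (h * k) X = M.ad h (M.ad k X) := by
  apply M.incl_injective
  rw [M.incl_ad, M.incl_ad, M.incl_ad]
  exact congrArg (fun A => A (M.incl X)) (Ad_mul (E := E) (h : G) (k : G))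

/-- The equivalence relation `(g, X) ∼ (g h, Ad_{h⁻¹} X)`, `h ∈ H`, on `G × M`. -/
def assocSetoid (M : InvariantComplement (E := E) H) : Setoid (G × M.normed) where
  r p q := ∃ h : H, q.1 = p.1 * h ∧ q.2 = M.ad h⁻¹ p.2
  iseqv :=
    { refl := fun p => ⟨1, by simp, by rw [inv_one, M.ad_one]⟩
      symm := by
        rintro p q ⟨h, h1, h2⟩
        refine ⟨h⁻¹, by simp [h1], ?_⟩
        rw [h2, inv_inv, ← M.ad_mul, mul_inv_cancel, M.ad_one]
      trans := by
        rintro p q r ⟨h, h1, h2⟩ ⟨k, k1, k2⟩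
        refine ⟨h * k, by simp [h1, k1, mul_assoc], ?_⟩
        rw [k2, h2, mul_inv_rev, M.ad_mul] }

/-- The associated bundle `G ×_{Ad_H} M`, with the quotient topology. -/
def AssocBundle (M : InvariantComplement (E := E) H) : Type _ := Quotient (assocSetoid M)

namespace AssocBundle

variable (M : InvariantComplement (E := E) H)

instance : TopologicalSpace (AssocBundle M) :=
  inferInstanceAs (TopologicalSpace (Quotient (assocSetoid M)))

/-- The class `[g, X]`. -/
def mk (p : G × M.normed) : AssocBundle M := Quotient.mk (assocSetoid M) p

/-- The bundle projection `[g, X] ↦ gH`. -/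
def proj : AssocBundle M → G ⧸ H :=
  Quotient.lift (fun p => (p.1 : G ⧸ H)) (by
    rintro p q ⟨h, h1, -⟩
    exact QuotientGroup.eq.2 (by rw [h1]; simp))

/-- The fibre of `G ×_{Ad_H} M` over `x`. -/
def Fiber (x : G ⧸ H) : Type _ := {p : AssocBundle M // proj M p = x}

lemma mk_eq_iff (p q : G × M.normed) :
    mk M p = mk M q ↔ ∃ h : H, q.1 = p.1 * h ∧ q.2 = M.ad h⁻¹ p.2 :=
  Quotient.eq (r := assocSetoid M)

variable {M} in
/-- For `g` over `x`, the bijection `X ↦ [g, X]` from `M` to the fibre over `x`. -/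
def fiberEquiv {x : G ⧸ H} (g : G) (hg : (g : G ⧸ H) = x) : M.normed ≃ Fiber M x :=
  Equiv.ofBijective (fun X => ⟨mk M (g, X), hg⟩) (by
    constructor
    · intro X Y hXY
      obtain ⟨h, h1, h2⟩ := (mk_eq_iff M _ _).1 (congrArg Subtype.val hXY)
      have : h = 1 := by simpa using h1
      subst this
      rw [inv_one, M.ad_one] at h2
      exact h2.symm
    · rintro ⟨p, hp⟩
      induction p using Quotient.inductionOn with
      | h p =>
        have hp' : (g : G ⧸ H) = (p.1 : G ⧸ H) := hg.trans hp.symm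
        have hmem := QuotientGroup.eq.1 hp'
        refine ⟨M.ad ⟨_, hmem⟩ p.2, Subtype.ext ?_⟩
        refine (mk_eq_iff M _ _).2 ⟨⟨_, hmem⟩, by simp, ?_⟩
        rw [← M.ad_mul, inv_mul_cancel, M.ad_one])

/-- The vector space structure of the fibres of `G ×_{Ad_H} M`, transported from `M` along
`X ↦ [g, X]` for a choice of `g` over `x`; `fiberLinearEquiv` shows that the choice of `g` does
not matter. -/
instance (x : G ⧸ H) : AddCommGroup (Fiber M x) :=
  (fiberEquiv (M := M) x.out (Quotient.out_eq x)).symm.addCommGroup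

instance (x : G ⧸ H) : Module ℝ (Fiber M x) :=
  (fiberEquiv (M := M) x.out (Quotient.out_eq x)).symm.module ℝ

variable {M} in
/-- For every `g` over `x`, the bijection `X ↦ [g, X]` from `M` to the fibre over `x` is linear. -/
def fiberLinearEquiv {x : G ⧸ H} (g : G) (hg : (g : G ⧸ H) = x) : M.normed ≃ₗ[ℝ] Fiber M x :=
  have key : ∃ h : H, ∀ X, fiberEquiv g hg X =
      fiberEquiv (M := M) x.out (Quotient.out_eq x) (M.ad h X) := by
    have hmem : x.out⁻¹ * g ∈ H := QuotientGroup.eq.1 ((Quotient.out_eq x).trans hg.symm)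
    refine ⟨⟨_, hmem⟩, fun X => Subtype.ext ?_⟩
    refine ((mk_eq_iff M _ _).2 ⟨⟨_, hmem⟩, by simp, ?_⟩).symm
    rw [← M.ad_mul, inv_mul_cancel, M.ad_one]
  { fiberEquiv g hg with
    map_add' := by
      obtain ⟨h, hh⟩ := key
      intro X Y
      apply (fiberEquiv (M := M) x.out (Quotient.out_eq x)).symm.injective
      simp only [Equiv.toFun_as_coe, Equiv.add_def, Equiv.symm_symm, hh, Equiv.symm_apply_apply,
        map_add]
    map_smul' := by
      obtain ⟨h, hh⟩ := key
      intro c X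
      apply (fiberEquiv (M := M) x.out (Quotient.out_eq x)).symm.injective
      simp only [Equiv.toFun_as_coe, Equiv.smul_def, Equiv.symm_symm, hh, Equiv.symm_apply_apply,
        map_smul, RingHom.id_apply] }

end AssocBundle

end Associated

/-! ### Connections and geodesics -/

section Geodesics

variable {F : Type*} [NormedAddCommGroup F] [NormedSpace ℝ F]
  {N : Type*} [TopologicalSpace N] [ChartedSpace F N]

/-- The velocity `c'(t)` of a curve. -/
def velocity (c : ℝ → N) (t : ℝ) : TangentSpace 𝓘(ℝ, F) (c t) :=
  mfderiv 𝓘(ℝ, ℝ) 𝓘(ℝ, F) c t (1 : ℝ)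

/-- The covariant derivative `DV/dt` at `t₀` of a vector field `V` along a curve `c`. In the local
trivialization of the tangent bundle around `c t₀` given by a chart, `V` is a curve `v` in `F`, each
`w : F` extends to a constant local vector field `σ_w`, and
`DV/dt (t₀) = v'(t₀) + (∇_{c'(t₀)} σ_{v(t₀)}) (c t₀)`. -/
def covDerivAlong [IsManifold 𝓘(ℝ, F) 1 N]
    (cov : CovariantDerivative 𝓘(ℝ, F) F (TangentSpace 𝓘(ℝ, F) : N → Type _))
    (c : ℝ → N) (V : ∀ t, TangentSpace 𝓘(ℝ, F) (c t)) (t₀ : ℝ) : TangentSpace 𝓘(ℝ, F) (c t₀) :=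
  let e := trivializationAt F (TangentSpace 𝓘(ℝ, F) : N → Type _) (c t₀)
  let v : ℝ → F := fun t => (e ⟨c t, V t⟩).2
  e.symm (c t₀) (deriv v t₀) + cov (fun x => e.symm x (v t₀)) (c t₀) (velocity c t₀)

/-- `c` is a geodesic of `∇` on the open interval `J`: it is smooth there and its velocity is
parallel along it. -/
def IsGeodesicOn [IsManifold 𝓘(ℝ, F) 1 N]
    (cov : CovariantDerivative 𝓘(ℝ, F) F (TangentSpace 𝓘(ℝ, F) : N → Type _))
    (c : ℝ → N) (J : Set ℝ) : Prop :=
  ContMDiffOn 𝓘(ℝ, ℝ) 𝓘(ℝ, F) ∞ c J ∧ ∀ t ∈ J, covDerivAlong cov c (velocity c) t = 0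

end Geodesics

section Connections

variable {E : Type*} [NormedAddCommGroup E] [NormedSpace ℝ E]
  {G : Type*} [TopologicalSpace G] [ChartedSpace E G] [Group G] [LieGroup 𝓘(ℝ, E) ∞ G]

/-- The canonical left-invariant connection on `TG`: a vector field `σ` is identified, through the
isomorphisms `(L_g)_* : T_e G → T_g G`, with a function `f : G → T_e G`, and then differentiated as
such a function, `∇_w σ = (L_g)_* (df_g w)`. -/
def IsCanonicalLeftInvariant
    (cov : CovariantDerivative 𝓘(ℝ, E) E (TangentSpace 𝓘(ℝ, E) : G → Type _)) : Prop :=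
  ∀ (σ : ∀ g : G, TangentSpace 𝓘(ℝ, E) g) (f : G → E),
    (∀ g, σ g = dL g (f g : E)) →
    ∀ g : G, MDifferentiableAt 𝓘(ℝ, E) (𝓘(ℝ, E).prod 𝓘(ℝ, E))
        (fun x => (⟨x, σ x⟩ : TangentBundle 𝓘(ℝ, E) G)) g →
      ∀ w : TangentSpace 𝓘(ℝ, E) g, cov σ g w = dL g (mvfderiv 𝓘(ℝ, E) f g w : E)

variable {F : Type*} [NormedAddCommGroup F] [NormedSpace ℝ F] {H : Subgroup G}
  [ChartedSpace F (G ⧸ H)]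

/-- The differential `π_* : T_g G → T_{gH} (G/H)` of the projection `π : G → G/H`. -/
def dπ (F : Type*) [NormedAddCommGroup F] [NormedSpace ℝ F] (H : Subgroup G)
    [ChartedSpace F (G ⧸ H)] (g : G) :
    TangentSpace 𝓘(ℝ, E) g →L[ℝ] TangentSpace 𝓘(ℝ, F) (g : G ⧸ H) :=
  mfderiv 𝓘(ℝ, E) 𝓘(ℝ, F) (fun x : G => (x : G ⧸ H)) g

/-- A (principal) connection on the principal `H`-bundle `π : G → G/H`, as a distribution of
horizontal spaces: complementary to the vertical spaces `ker π_*`, invariant under right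
multiplication by `H`, and smooth, i.e. each horizontal vector extends to a smooth horizontal local
vector field. -/
structure IsPrincipalConnection (F : Type*) [NormedAddCommGroup F] [NormedSpace ℝ F]
    (H : Subgroup G) [ChartedSpace F (G ⧸ H)]
    (D : ∀ g : G, Submodule ℝ (TangentSpace 𝓘(ℝ, E) g)) : Prop where
  isCompl : ∀ g, IsCompl (dπ F H g).ker (D g)
  right_invariant : ∀ h ∈ H, ∀ g,
    (D g).map (mfderiv 𝓘(ℝ, E) 𝓘(ℝ, E) (fun x : G => x * h) g).toLinearMap = D (g * h)
  smooth : ∀ g, ∀ w ∈ D g, ∃ V : ∀ x : G, TangentSpace 𝓘(ℝ, E) x,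
    V g = w ∧ (∀ᶠ x in 𝓝 g, V x ∈ D x) ∧
      ContMDiffAt 𝓘(ℝ, E) (𝓘(ℝ, E).prod 𝓘(ℝ, E)) ∞
        (fun x => (⟨x, V x⟩ : TangentBundle 𝓘(ℝ, E) G)) g

/-- The left-invariant distribution `𝔪` with `𝔪_g = (L_g)_* M`. -/
def horizontal (M : InvariantComplement (E := E) H) (g : G) :
    Submodule ℝ (TangentSpace 𝓘(ℝ, E) g) :=
  M.space.map (dL g).toLinearMap

/-- The vector `π_* (L_g)_* X ∈ T_{gH} (G/H)`. -/
def toTangent (F : Type*) [NormedAddCommGroup F] [NormedSpace ℝ F] {H : Subgroup G}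
    [ChartedSpace F (G ⧸ H)] (M : InvariantComplement (E := E) H) (g : G) (X : M.normed) :
    TangentSpace 𝓘(ℝ, F) (g : G ⧸ H) :=
  dπ F H g (dL g (M.incl X))

/-- `∇` is the connection on `T(G/H)` induced by the horizontal distribution `D` on the principal
bundle `G → G/H` through `G ×_{Ad_H} M → T(G/H)`, `[g, X] ↦ π_* (L_g)_* X`: if the vector field `σ`
corresponds to the section `gH ↦ [g, f g]` of the associated bundle, then, for `w` horizontal at
`g`, the vector `∇_{π_* w} σ` corresponds to `[g, df_g w]`. -/
def IsInducedConnection [IsManifold 𝓘(ℝ, F) 1 (G ⧸ H)] (M : InvariantComplement (E := E) H)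
    (D : ∀ g : G, Submodule ℝ (TangentSpace 𝓘(ℝ, E) g))
    (cov : CovariantDerivative 𝓘(ℝ, F) F (TangentSpace 𝓘(ℝ, F) : G ⧸ H → Type _)) : Prop :=
  ∀ (σ : ∀ x : G ⧸ H, TangentSpace 𝓘(ℝ, F) x) (f : G → M.normed),
    (∀ g : G, σ (g : G ⧸ H) = toTangent F M g (f g)) →
    ∀ g : G, MDifferentiableAt 𝓘(ℝ, F) (𝓘(ℝ, F).prod 𝓘(ℝ, F))
        (fun x => (⟨x, σ x⟩ : TangentBundle 𝓘(ℝ, F) (G ⧸ H))) (g : G ⧸ H) →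
      ∀ w ∈ D g, cov σ (g : G ⧸ H) (dπ F H g w) = toTangent F M g (mvfderiv 𝓘(ℝ, E) f g w)

end Connections

end Homogeneous

end

/-! The geometry of `G → G/H` enters only through a small package, `HorizontalFraming`: a submersion
`pr : P → N`, a smooth horizontal lift `A → T_p P` that becomes an isomorphism `frame p : A ≃ T_{pr
p} N` after `pr_*`, and symmetries over `N` joining any two points of a fibre and preserving the
lifts up to a linear map of `A`. Both connections are instances: `quotientFraming` (`P = G`, `N =
G/H`, `A = M`, symmetries the right multiplications by `H`) and `leftInvariantFraming` (`P = N = G`,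
`A = T_e G`).

A vector field `σ` on `N` is the same as the function `rep σ : P → A` with `frame p (rep σ p) = σ
(pr p)`. Differentiating `rep σ` along horizontal lifts and returning through `frame p` gives a
covariant derivative; the symmetries make it independent of the point of the fibre
(`covAt_eq_of_proj_eq`), and local sections of `pr` make it smooth. As the frame vectors span each
`T_x N`, the formula determines the connection on differentiable fields.

For a horizontal curve `γ` with velocity `lift (γ t) (x t)`, the acceleration of `pr ∘ γ` is `frame
(γ t) (x' t)` (`covDerivAlong_velocity`). Hence a projected horizontal curve is a geodesic when `x`
is constant. Conversely a geodesic has local horizontal lifts, solutions of an ordinary differential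
equation, and injectivity of the frame forces `x' = 0`. Left-invariant fields are complete, and a
connectedness argument extends the local lift to the whole interval (`exists_global_lift`). The
statement about `∇^G` is the same fact for the second framing: its geodesics are integral curves of
left-invariant fields, horizontal at one time exactly when the generating vector lies in `M`.

That `G → G/H` with `M` is a framing rests on `mfderivModel_quotient_eq_zero_iff`: the kernel of
`π_*` at `g` is `(L_g)_* T_e H`. The complement `M` is therefore carried isomorphically onto the
tangent space of `G/H`, and `Ad_H`-invariance of `M` gives the symmetries.

For the associated bundle, `(g, X) ↦ π_* (L_g)_* X` is a continuous open surjection onto `T(G/H)`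
whose fibres are exactly the classes `[g, X]`. It descends to a homeomorphism, the smooth structure
is transported through it, and the quotient map is a submersion because it is a linear projection in
charts built from a frame and adapted charts of `π`. -/

noncomputable section

namespace Homogeneous

/-! ### Derivatives read in the model spaces -/

section ModelDerivative

variable {E : Type*} [NormedAddCommGroup E] [NormedSpace ℝ E]
  {F : Type*} [NormedAddCommGroup F] [NormedSpace ℝ F]
  {K : Type*} [NormedAddCommGroup K] [NormedSpace ℝ K]
  {P : Type*} [TopologicalSpace P] [ChartedSpace E P]
  {N : Type*} [TopologicalSpace N] [ChartedSpace F N]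
  {Q : Type*} [TopologicalSpace Q] [ChartedSpace K Q]

variable (E F) in
/-- The manifold derivative, as a map between the model spaces. -/
def mfderivModel (f : P → N) (p : P) : E →L[ℝ] F := mfderiv 𝓘(ℝ, E) 𝓘(ℝ, F) f p

lemma mfderivModel_comp {g : N → Q} {f : P → N} (p : P)
    (hg : MDifferentiableAt 𝓘(ℝ, F) 𝓘(ℝ, K) g (f p))
    (hf : MDifferentiableAt 𝓘(ℝ, E) 𝓘(ℝ, F) f p) :
    mfderivModel E K (fun x => g (f x)) p =
      (mfderivModel F K g (f p)).comp (mfderivModel E F f p) :=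
  mfderiv_comp p hg hf

lemma mfderivModel_congr {f g : P → N} {p : P} (h : f =ᶠ[𝓝 p] g) :
    mfderivModel E F f p = mfderivModel E F g p :=
  h.mfderiv_eq

lemma mfderivModel_id (p : P) : mfderivModel E E (fun x : P => x) p = ContinuousLinearMap.id ℝ E :=
  mfderiv_id

lemma mfderivModel_eq_fderiv (f : E → F) (p : E) : mfderivModel E F f p = fderiv ℝ f p :=
  mfderiv_eq_fderiv

/-- A curve has velocity `v` at time `t`. -/
def HasVelocityAt (γ : ℝ → P) (v : E) (t : ℝ) : Prop :=
  HasMFDerivAt 𝓘(ℝ, ℝ) 𝓘(ℝ, E) γ t ((1 : ℝ →L[ℝ] ℝ).smulRight v : ℝ →L[ℝ] E)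

lemma HasVelocityAt.mdifferentiableAt {γ : ℝ → P} {v : E} {t : ℝ} (h : HasVelocityAt γ v t) :
    MDifferentiableAt 𝓘(ℝ, ℝ) 𝓘(ℝ, E) γ t :=
  HasMFDerivAt.mdifferentiableAt h

lemma HasVelocityAt.velocity_eq {γ : ℝ → P} {v : E} {t : ℝ} (h : HasVelocityAt γ v t) :
    (velocity γ t : E) = v := by
  have h1 : (mfderiv 𝓘(ℝ, ℝ) 𝓘(ℝ, E) γ t : ℝ →L[ℝ] E) =
    (1 : ℝ →L[ℝ] ℝ).smulRight v := HasMFDerivAt.mfderiv h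
  exact (congrArg (fun A : ℝ →L[ℝ] E => A (1 : ℝ)) h1).trans (one_smul ℝ v)

lemma HasVelocityAt.comp {f : P → N} {γ : ℝ → P} {v : E} {t : ℝ}
    (hf : MDifferentiableAt 𝓘(ℝ, E) 𝓘(ℝ, F) f (γ t)) (h : HasVelocityAt γ v t) :
    HasVelocityAt (fun s => f (γ s)) (mfderivModel E F f (γ t) v) t := by
  have key : (mfderivModel E F f (γ t)).comp ((1 : ℝ →L[ℝ] ℝ).smulRight v : ℝ →L[ℝ] E) =
      (1 : ℝ →L[ℝ] ℝ).smulRight (mfderivModel E F f (γ t) v) := by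
    ext; simp
  exact (hf.hasMFDerivAt.comp t h).congr_mfderiv key

lemma HasVelocityAt.congr {γ δ : ℝ → P} {v : E} {t : ℝ} (h : HasVelocityAt γ v t)
    (hδ : δ =ᶠ[𝓝 t] γ) : HasVelocityAt δ v t :=
  HasMFDerivAt.congr_of_eventuallyEq h hδ

lemma hasVelocityAt_iff_hasDerivAt {γ : ℝ → E} {v : E} {t : ℝ} :
    HasVelocityAt γ v t ↔ HasDerivAt γ v t := by
  unfold HasVelocityAt
  rw [hasDerivAt_iff_hasFDerivAt]
  exact hasMFDerivAt_iff_hasFDerivAt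

end ModelDerivative

/-! ### Smoothness of operator-valued functions. -/

section Operators

variable {𝕂 : Type*} [NormedAddCommGroup 𝕂] [NormedSpace ℝ 𝕂]
  {E : Type*} [NormedAddCommGroup E] [NormedSpace ℝ E]
  {P : Type*} [TopologicalSpace P] [ChartedSpace E P]
  {A : Type*} [NormedAddCommGroup A] [NormedSpace ℝ A]
  {F : Type*} [NormedAddCommGroup F] [NormedSpace ℝ F]

/-- In a basis of `A` an operator is the sum of its values on the basis vectors tensored with the
coordinate forms, so finitely many vectors suffice to test smoothness. -/
lemma contMDiffAt_clm_of_apply [FiniteDimensional ℝ A] {n : ℕ∞ω} {f : P → A →L[ℝ] F} {p : P}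
    (h : ∀ a, ContMDiffAt 𝓘(ℝ, E) 𝓘(ℝ, F) n (fun x => f x a) p) :
    ContMDiffAt 𝓘(ℝ, E) 𝓘(ℝ, A →L[ℝ] F) n f p := by
  let b := Module.finBasis ℝ A
  let co : Fin (Module.finrank ℝ A) → A →L[ℝ] ℝ := fun i => (b.coord i).toContinuousLinearMap
  have hf : f = fun x => ∑ i, ContinuousLinearMap.smulRightL ℝ A F (co i) (f x (b i)) := by
    ext x a
    simp only [FunLike.coe_sum, Finset.sum_apply,
      ContinuousLinearMap.smulRightL_apply_apply]
    conv_lhs => rw [← b.sum_repr a, map_sum]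
    refine Finset.sum_congr rfl fun i _ => ?_
    rw [map_smul]; rfl
  rw [hf]
  refine contMDiffAt_finsetSum fun i _ => ?_
  exact (ContinuousLinearMap.smulRightL ℝ A F (co i)).contMDiff.contMDiffAt.comp p (h (b i))

/-- Inversion of operators is smooth near an invertible one; the default value of
`ContinuousLinearMap.inverse` elsewhere plays no role. -/
lemma contMDiffAt_inverse [CompleteSpace A] {n : ℕ∞ω} {f : P → A →L[ℝ] F} {p : P}
    (h : ContMDiffAt 𝓘(ℝ, E) 𝓘(ℝ, A →L[ℝ] F) n f p) (hp : (f p).IsInvertible) :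
    ContMDiffAt 𝓘(ℝ, E) 𝓘(ℝ, F →L[ℝ] A) n (fun x => (f x).inverse) p := by
  obtain ⟨u, hu⟩ := hp
  have := contDiffAt_map_inverse (𝕜 := ℝ) (n := n) u
  rw [hu] at this
  exact this.contMDiffAt.comp p h

end Operators

/-! ### Tangent bundle trivializations as operators between model spaces. -/

section Trivialization

variable {F : Type*} [NormedAddCommGroup F] [NormedSpace ℝ F]
  {N : Type*} [TopologicalSpace N] [ChartedSpace F N] [IsManifold 𝓘(ℝ, F) ∞ N]

/-- The set over which the trivialization of the tangent bundle at `x₀` is defined. -/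
def trivSet (x₀ : N) : Set N :=
  (trivializationAt F (TangentSpace 𝓘(ℝ, F) : N → Type _) x₀).baseSet

/-- The trivialization of the tangent bundle at `x₀`, as a linear map on `T_x N`. -/
def trivCoord (x₀ x : N) : F →L[ℝ] F :=
  (trivializationAt F (TangentSpace 𝓘(ℝ, F) : N → Type _) x₀).continuousLinearMapAt ℝ x

lemma isOpen_trivSet (x₀ : N) : IsOpen (trivSet (F := F) x₀) :=
  (trivializationAt F (TangentSpace 𝓘(ℝ, F) : N → Type _) x₀).open_baseSet

lemma mem_trivSet (x₀ : N) : x₀ ∈ trivSet (F := F) x₀ :=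
  FiberBundle.mem_baseSet_trivializationAt' x₀

lemma trivCoord_apply {x₀ x : N} (hx : x ∈ trivSet (F := F) x₀) (v : F) :
    trivCoord x₀ x v =
      (trivializationAt F (TangentSpace 𝓘(ℝ, F) : N → Type _) x₀ ⟨x, v⟩).2 :=
  Bundle.Trivialization.continuousLinearMapAt_apply_of_mem (R := ℝ) _ hx v

/-- The trivialization of the tangent bundle at `x₀`, as an isomorphism on `T_x N`. -/
def trivEquiv {x₀ x : N} (hx : x ∈ trivSet (F := F) x₀) : F ≃L[ℝ] F :=
  (trivializationAt F (TangentSpace 𝓘(ℝ, F) : N → Type _) x₀).continuousLinearEquivAt ℝ x hx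

lemma coe_trivEquiv {x₀ x : N} (hx : x ∈ trivSet (F := F) x₀) :
    (trivEquiv hx : F →L[ℝ] F) = trivCoord x₀ x :=
  ContinuousLinearMap.ext fun v => (trivCoord_apply hx v).symm

lemma isInvertible_trivCoord {x₀ x : N} (hx : x ∈ trivSet (F := F) x₀) :
    (trivCoord (F := F) x₀ x).IsInvertible :=
  ⟨trivEquiv hx, coe_trivEquiv hx⟩

lemma trivCoord_inverse {x₀ x : N} (hx : x ∈ trivSet (F := F) x₀) (v : F) :
    (trivCoord (F := F) x₀ x).inverse v =
      (trivializationAt F (TangentSpace 𝓘(ℝ, F) : N → Type _) x₀).symm x v := by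
  rw [← coe_trivEquiv hx, ContinuousLinearMap.inverse_equiv]
  rfl

end Trivialization

/-! ### Horizontal framings of submersions -/

section TangentOperators

variable {E F A : Type*} [NormedAddCommGroup E] [NormedSpace ℝ E]
    [NormedAddCommGroup F] [NormedSpace ℝ F]
    [NormedAddCommGroup A] [NormedSpace ℝ A] [FiniteDimensional ℝ A]
    {P : Type*} [TopologicalSpace P] [ChartedSpace E P]
    {N : Type*} [TopologicalSpace N] [ChartedSpace F N] [IsManifold 𝓘(ℝ, F) ∞ N]
    {f : P → N} {L : P → A →L[ℝ] F} {p : P}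

/-- A family of maps into varying tangent spaces becomes operator-valued once a trivialization is
fixed. This makes composition and inversion of operators available for frames. -/
lemma contMDiffAt_trivCoord_comp {x₀ : N} (hp : f p ∈ trivSet (F := F) x₀)
    (h : ∀ a, ContMDiffAt 𝓘(ℝ, E) (𝓘(ℝ, F).prod 𝓘(ℝ, F)) ∞
      (fun q => (⟨f q, L q a⟩ : TangentBundle 𝓘(ℝ, F) N)) p) :
    ContMDiffAt 𝓘(ℝ, E) 𝓘(ℝ, A →L[ℝ] F) ∞ (fun q => (trivCoord x₀ (f q)).comp (L q)) p := by
  have h0 : ContMDiffAt 𝓘(ℝ, E) 𝓘(ℝ, F) ∞ f p := (Bundle.contMDiffAt_totalSpace.1 (h 0)).1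
  refine contMDiffAt_clm_of_apply fun a => ?_
  have h := ((trivializationAt F (TangentSpace 𝓘(ℝ, F) : N → Type _) x₀).contMDiffAt_iff
    (n := ∞) (IM := 𝓘(ℝ, E)) (IB := 𝓘(ℝ, F))
    (f := fun q => (⟨f q, L q a⟩ : TangentBundle 𝓘(ℝ, F) N)) (x₀ := p)
    ((Bundle.Trivialization.mem_source _).2 hp)).1 (h a)
  refine h.2.congr_of_eventuallyEq ?_
  filter_upwards [h0.continuousAt.eventually ((isOpen_trivSet x₀).mem_nhds hp)] with q hq
  exact trivCoord_apply hq (L q a)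

lemma contMDiffAt_tangent_apply {K HK : Type*} [NormedAddCommGroup K] [NormedSpace ℝ K]
    [TopologicalSpace HK] {I : ModelWithCorners ℝ K HK} {Q : Type*} [TopologicalSpace Q]
    [ChartedSpace HK Q] {g : Q → P} {a : Q → A} {q : Q}
    (h : ∀ a, ContMDiffAt 𝓘(ℝ, E) (𝓘(ℝ, F).prod 𝓘(ℝ, F)) ∞
      (fun p => (⟨f p, L p a⟩ : TangentBundle 𝓘(ℝ, F) N)) (g q))
    (hg : ContMDiffAt I 𝓘(ℝ, E) ∞ g q) (ha : ContMDiffAt I 𝓘(ℝ, A) ∞ a q) :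
    ContMDiffAt I (𝓘(ℝ, F).prod 𝓘(ℝ, F)) ∞
      (fun z => (⟨f (g z), L (g z) (a z)⟩ : TangentBundle 𝓘(ℝ, F) N)) q := by
  have h0 : ContMDiffAt I 𝓘(ℝ, F) ∞ (fun z => f (g z)) q :=
    (Bundle.contMDiffAt_totalSpace.1 (h 0)).1.comp q hg
  have hm := mem_trivSet (F := F) (f (g q))
  refine Bundle.contMDiffAt_totalSpace.2 ⟨h0, ?_⟩
  refine (((contMDiffAt_trivCoord_comp hm h).comp q hg).clm_apply ha).congr_of_eventuallyEq ?_
  filter_upwards [h0.continuousAt.eventually ((isOpen_trivSet _).mem_nhds hm)] with z hz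
  exact (trivCoord_apply hz (L (g z) (a z))).symm

end TangentOperators

/-! ### Framed submersions and the covariant derivative at a point of the fibre. -/

section Framing

/-- A surjective submersion `pr : P → N` with a smooth family of injective maps `A → T_p P`, whose
images are horizontal spaces and which becomes a family of isomorphisms `A → T_{pr p} N` after
applying `pr_*`. Points of a common fibre are related by symmetries over `N` which preserve the
family up to linear maps of `A`. The tangent spaces of `P` are read in the model space. -/
structure HorizontalFraming (E F A : Type*) [NormedAddCommGroup E] [NormedSpace ℝ E]
    [NormedAddCommGroup F] [NormedSpace ℝ F] [NormedAddCommGroup A] [NormedSpace ℝ A]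
    {P : Type*} [TopologicalSpace P] [ChartedSpace E P] [IsManifold 𝓘(ℝ, E) 1 P]
    {N : Type*} [TopologicalSpace N] [ChartedSpace F N] (pr : P → N) where
  /-- The horizontal lift `A → T_p P`. -/
  lift : P → A →L[ℝ] E
  contMDiff_proj : ContMDiff 𝓘(ℝ, E) 𝓘(ℝ, F) ∞ pr
  surjective : Function.Surjective pr
  contMDiff_lift : ∀ a, ContMDiff 𝓘(ℝ, E) (𝓘(ℝ, E).prod 𝓘(ℝ, E)) ∞
    (fun p => (⟨p, lift p a⟩ : TangentBundle 𝓘(ℝ, E) P))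
  isInvertible_frame : ∀ p, ((mfderivModel E F pr p).comp (lift p)).IsInvertible
  exists_section : ∀ p, ∃ s : N → P, s (pr p) = p ∧ ContMDiffAt 𝓘(ℝ, F) 𝓘(ℝ, E) ∞ s (pr p) ∧
    ∀ᶠ x in 𝓝 (pr p), pr (s x) = x
  exists_symm : ∀ p q, pr p = pr q → ∃ (R : P → P) (ρ : A →L[ℝ] A),
    ContMDiff 𝓘(ℝ, E) 𝓘(ℝ, E) ∞ R ∧ R p = q ∧ (∀ r, pr (R r) = pr r) ∧
    ∀ r a, mfderivModel E E R r (lift r a) = lift (R r) (ρ a)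

variable {E F A : Type*} [NormedAddCommGroup E] [NormedSpace ℝ E]
    [NormedAddCommGroup F] [NormedSpace ℝ F] [NormedAddCommGroup A] [NormedSpace ℝ A]
    {P : Type*} [TopologicalSpace P] [ChartedSpace E P] [IsManifold 𝓘(ℝ, E) ∞ P]
    {N : Type*} [TopologicalSpace N] [ChartedSpace F N] {pr : P → N}

namespace HorizontalFraming

variable (fr : HorizontalFraming E F A pr)

lemma mdifferentiableAt_proj (fr : HorizontalFraming E F A pr) (p : P) :
    MDifferentiableAt 𝓘(ℝ, E) 𝓘(ℝ, F) pr p :=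
  fr.contMDiff_proj.mdifferentiableAt (by simp)

/-- The isomorphism `A → T_{pr p} N`. -/
def frame (p : P) : A →L[ℝ] F := (mfderivModel E F pr p).comp (fr.lift p)

lemma isInvertible (p : P) : (fr.frame p).IsInvertible := fr.isInvertible_frame p

variable [IsManifold 𝓘(ℝ, F) ∞ N]

/-- The isomorphism `A → T_{pr p} N` in the trivialization of `T N` at `x₀`. -/
def frameCoord (x₀ : N) (p : P) : A →L[ℝ] F := (trivCoord x₀ (pr p)).comp (fr.frame p)

lemma isInvertible_frameCoord {x₀ : N} {p : P} (hp : pr p ∈ trivSet (F := F) x₀) :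
    (fr.frameCoord x₀ p).IsInvertible :=
  (isInvertible_trivCoord hp).comp (fr.isInvertible p)

lemma preimage_trivSet_mem_nhds (fr : HorizontalFraming E F A pr)
    {x₀ : N} {p : P} (hp : pr p ∈ trivSet (F := F) x₀) :
    ∀ᶠ q in 𝓝 p, pr q ∈ trivSet (F := F) x₀ :=
  fr.contMDiff_proj.continuous.continuousAt.eventually ((isOpen_trivSet x₀).mem_nhds hp)

lemma contMDiff_frame (a : A) : ContMDiff 𝓘(ℝ, E) (𝓘(ℝ, F).prod 𝓘(ℝ, F)) ∞
    (fun p => (⟨pr p, fr.frame p a⟩ : TangentBundle 𝓘(ℝ, F) N)) :=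
  (fr.contMDiff_proj.contMDiff_tangentMap (m := ∞) (by simp)).comp (fr.contMDiff_lift a)

variable [FiniteDimensional ℝ A]

lemma contMDiffAt_frameCoord {x₀ : N} {p : P} (hp : pr p ∈ trivSet (F := F) x₀) :
    ContMDiffAt 𝓘(ℝ, E) 𝓘(ℝ, A →L[ℝ] F) ∞ (fr.frameCoord x₀) p :=
  contMDiffAt_trivCoord_comp hp fun a => fr.contMDiff_frame a p

lemma contMDiffAt_frameCoord_inverse {x₀ : N} {p : P} (hp : pr p ∈ trivSet (F := F) x₀) :
    ContMDiffAt 𝓘(ℝ, E) 𝓘(ℝ, F →L[ℝ] A) ∞ (fun q => (fr.frameCoord x₀ q).inverse) p :=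
  have : CompleteSpace A := FiniteDimensional.complete ℝ A
  contMDiffAt_inverse (fr.contMDiffAt_frameCoord hp) (fr.isInvertible_frameCoord hp)

omit [FiniteDimensional ℝ A]

/-- The `A`-valued function on `P` which represents a vector field on `N`. -/
def rep (σ : ∀ x : N, TangentSpace 𝓘(ℝ, F) x) (p : P) : A := (fr.frame p).inverse (σ (pr p))

omit [IsManifold 𝓘(ℝ, F) ∞ N] in
lemma frame_rep (σ : ∀ x : N, TangentSpace 𝓘(ℝ, F) x) (p : P) :
    fr.frame p (fr.rep σ p) = σ (pr p) :=
  (fr.isInvertible p).self_apply_inverse _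

omit [IsManifold 𝓘(ℝ, F) ∞ N] in
lemma rep_eq_of_frame_eq {σ : ∀ x : N, TangentSpace 𝓘(ℝ, F) x} {p : P} {a : A}
    (h : fr.frame p a = σ (pr p)) : fr.rep σ p = a :=
  (fr.isInvertible p).injective ((fr.frame_rep σ p).trans h.symm)

/-- The trivialization cancels between the frame and the field. The right side combines a smooth
operator family with the coordinates of `σ`, so the regularity of `σ` passes to `rep σ`. -/
lemma rep_eq_frameCoord_inverse {x₀ : N} {p : P} (hp : pr p ∈ trivSet (F := F) x₀)
    (σ : ∀ x : N, TangentSpace 𝓘(ℝ, F) x) :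
    fr.rep σ p = (fr.frameCoord x₀ p).inverse
      (trivializationAt F (TangentSpace 𝓘(ℝ, F) : N → Type _) x₀ ⟨pr p, σ (pr p)⟩).2 := by
  refine ((fr.isInvertible_frameCoord hp).inverse_apply_eq.2 ?_).symm
  exact (trivCoord_apply hp (σ (pr p))).symm.trans
    (congrArg (trivCoord x₀ (pr p)) (fr.frame_rep σ p).symm)

lemma mdifferentiableAt_rep [FiniteDimensional ℝ A] {σ : ∀ x : N, TangentSpace 𝓘(ℝ, F) x} {p : P}
    (hσ : MDifferentiableAt 𝓘(ℝ, F) (𝓘(ℝ, F).prod 𝓘(ℝ, F))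
      (fun x => (⟨x, σ x⟩ : TangentBundle 𝓘(ℝ, F) N)) (pr p)) :
    MDifferentiableAt 𝓘(ℝ, E) 𝓘(ℝ, A) (fr.rep σ) p := by
  have hp := mem_trivSet (F := F) (pr p)
  have h1 := (mdifferentiableAt_section (IB := 𝓘(ℝ, F)) (F := F)
    (E := (TangentSpace 𝓘(ℝ, F) : N → Type _)) σ).1 hσ
  have h2 := h1.comp p (fr.mdifferentiableAt_proj p)
  refine ((((fr.contMDiffAt_frameCoord_inverse hp).mdifferentiableAt (by simp)).clm_apply
    h2)).congr_of_eventuallyEq ?_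
  filter_upwards [fr.preimage_trivSet_mem_nhds hp] with q hq
  exact fr.rep_eq_frameCoord_inverse hq σ

lemma contMDiffAt_rep [FiniteDimensional ℝ A] {σ : ∀ x : N, TangentSpace 𝓘(ℝ, F) x} {p : P}
    (hσ : ContMDiffAt 𝓘(ℝ, F) (𝓘(ℝ, F).prod 𝓘(ℝ, F)) ∞
      (fun x => (⟨x, σ x⟩ : TangentBundle 𝓘(ℝ, F) N)) (pr p)) :
    ContMDiffAt 𝓘(ℝ, E) 𝓘(ℝ, A) ∞ (fr.rep σ) p := by
  have hp := mem_trivSet (F := F) (pr p)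
  have h1 := (Bundle.contMDiffAt_section (IB := 𝓘(ℝ, F)) (F := F)
    (E := (TangentSpace 𝓘(ℝ, F) : N → Type _)) (s := σ) (pr p)).1 hσ
  have h2 := h1.comp p (fr.contMDiff_proj p)
  refine ((fr.contMDiffAt_frameCoord_inverse hp).clm_apply h2).congr_of_eventuallyEq ?_
  filter_upwards [fr.preimage_trivSet_mem_nhds hp] with q hq
  exact fr.rep_eq_frameCoord_inverse hq σ

/-- The derivative of the representing function in horizontal directions, as an endomorphism
of `A`. -/
def repDeriv (σ : ∀ x : N, TangentSpace 𝓘(ℝ, F) x) (p : P) : A →L[ℝ] A :=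
  (mfderivModel E A (fr.rep σ) p).comp (fr.lift p)

/-- The covariant derivative at `pr p`, computed at the point `p` of the fibre. -/
def covAt (σ : ∀ x : N, TangentSpace 𝓘(ℝ, F) x) (p : P) : F →L[ℝ] F :=
  (fr.frame p).comp ((fr.repDeriv σ p).comp (fr.frame p).inverse)

omit [IsManifold 𝓘(ℝ, F) ∞ N] in
lemma covAt_frame (σ : ∀ x : N, TangentSpace 𝓘(ℝ, F) x) (p : P) (a : A) :
    fr.covAt σ p (fr.frame p a) = fr.frame p (fr.repDeriv σ p a) := by
  simp [covAt, (fr.isInvertible p).inverse_apply_self]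

/-- Take a symmetry `R` over `N` with `R p = q` and `R_* ∘ lift = lift ∘ ρ`. Then `frame r = frame
(R r) ∘ ρ`, hence `rep σ ∘ R = ρ ∘ rep σ`; differentiating this along lifts shows that `ρ`
intertwines the two horizontal derivatives. Evaluated on frame vectors, both covariant derivatives
then agree. Invertibility of `ρ` need not be assumed. -/
lemma covAt_eq_of_proj_eq [FiniteDimensional ℝ A] {σ : ∀ x : N, TangentSpace 𝓘(ℝ, F) x} {p q : P}
    (hpq : pr p = pr q)
    (hσ : MDifferentiableAt 𝓘(ℝ, F) (𝓘(ℝ, F).prod 𝓘(ℝ, F))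
      (fun x => (⟨x, σ x⟩ : TangentBundle 𝓘(ℝ, F) N)) (pr p)) :
    fr.covAt σ p = fr.covAt σ q := by
  obtain ⟨R, ρ, hR, rfl, hprR, hRρ⟩ := fr.exists_symm p q hpq
  have hR' : ∀ r, MDifferentiableAt 𝓘(ℝ, E) 𝓘(ℝ, E) R r :=
    fun r => hR.mdifferentiableAt (by simp)
  have hframe : ∀ r a, fr.frame r a = fr.frame (R r) (ρ a) := by
    intro r a
    have h1 : mfderivModel E F pr r = (mfderivModel E F pr (R r)).comp (mfderivModel E E R r) := by
      rw [← mfderivModel_comp r (fr.mdifferentiableAt_proj _) (hR' r)]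
      simp only [hprR]
    change mfderivModel E F pr r (fr.lift r a) = _
    rw [h1]
    exact congrArg (mfderivModel E F pr (R r)) (hRρ r a)
  have hrep : ∀ r, fr.rep σ (R r) = ρ (fr.rep σ r) := by
    intro r
    refine fr.rep_eq_of_frame_eq ?_
    rw [← hframe, fr.frame_rep]
    exact congrArg (fun x => (σ x : F)) (hprR r).symm
  have hd : ∀ a, fr.repDeriv σ (R p) (ρ a) = ρ (fr.repDeriv σ p a) := by
    intro a
    have hm : MDifferentiableAt 𝓘(ℝ, E) 𝓘(ℝ, A) (fr.rep σ) (R p) :=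
      fr.mdifferentiableAt_rep (hprR p ▸ hσ)
    have h1 := mfderivModel_comp p hm (hR' p)
    simp only [hrep] at h1
    have h2 := mfderivModel_comp (g := fun a : A => ρ a) (f := fr.rep σ) p
      ρ.differentiableAt.mdifferentiableAt (fr.mdifferentiableAt_rep hσ)
    rw [h2, mfderivModel_eq_fderiv, ρ.fderiv] at h1
    have h3 := congrArg (fun L : E →L[ℝ] A => L (fr.lift p a)) h1
    simp only [ContinuousLinearMap.comp_apply, hRρ] at h3
    exact h3.symm
  ext v
  obtain ⟨a, rfl⟩ := (fr.isInvertible p).surjective v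
  rw [covAt_frame, hframe, hframe p a, covAt_frame, hd]

end HorizontalFraming

end Framing

/-! ### The induced connection: Leibniz rule, uniqueness and smoothness. -/

section FramingConnection

variable {E F A : Type*} [NormedAddCommGroup E] [NormedSpace ℝ E]
    [NormedAddCommGroup F] [NormedSpace ℝ F] [NormedAddCommGroup A] [NormedSpace ℝ A]
    {P : Type*} [TopologicalSpace P] [ChartedSpace E P]

lemma mfderivModel_add {f g : P → A} {p : P} (hf : MDifferentiableAt 𝓘(ℝ, E) 𝓘(ℝ, A) f p)
    (hg : MDifferentiableAt 𝓘(ℝ, E) 𝓘(ℝ, A) g p) :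
    mfderivModel E A (fun q => f q + g q) p = mfderivModel E A f p + mfderivModel E A g p :=
  (hf.hasMFDerivAt.add hg.hasMFDerivAt).mfderiv

lemma mfderivModel_smul_apply {f : P → ℝ} {g : P → A} {p : P}
    (hf : MDifferentiableAt 𝓘(ℝ, E) 𝓘(ℝ, ℝ) f p) (hg : MDifferentiableAt 𝓘(ℝ, E) 𝓘(ℝ, A) g p)
    (v : E) :
    mfderivModel E A (fun q => f q • g q) p v =
      f p • mfderivModel E A g p v + mfderivModel E ℝ f p v • g p :=
  congrArg (fun L : E →L[ℝ] A => L v) (mvfderiv_smul hf hg)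

variable [IsManifold 𝓘(ℝ, E) ∞ P]
    {N : Type*} [TopologicalSpace N] [ChartedSpace F N] {pr : P → N}

namespace HorizontalFraming

variable (fr : HorizontalFraming E F A pr)

lemma rep_add (σ τ : ∀ x : N, TangentSpace 𝓘(ℝ, F) x) (p : P) :
    fr.rep (σ + τ) p = fr.rep σ p + fr.rep τ p :=
  map_add (fr.frame p).inverse _ _

lemma rep_smul (g : N → ℝ) (σ : ∀ x : N, TangentSpace 𝓘(ℝ, F) x) (p : P) :
    fr.rep (g • σ) p = g (pr p) • fr.rep σ p :=
  map_smul (fr.frame p).inverse _ _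

variable [IsManifold 𝓘(ℝ, F) ∞ N] [FiniteDimensional ℝ A]

lemma covAt_add {σ τ : ∀ x : N, TangentSpace 𝓘(ℝ, F) x} {p : P}
    (hσ : MDifferentiableAt 𝓘(ℝ, F) (𝓘(ℝ, F).prod 𝓘(ℝ, F))
      (fun x => (⟨x, σ x⟩ : TangentBundle 𝓘(ℝ, F) N)) (pr p))
    (hτ : MDifferentiableAt 𝓘(ℝ, F) (𝓘(ℝ, F).prod 𝓘(ℝ, F))
      (fun x => (⟨x, τ x⟩ : TangentBundle 𝓘(ℝ, F) N)) (pr p)) :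
    fr.covAt (σ + τ) p = fr.covAt σ p + fr.covAt τ p := by
  have h : fr.rep (σ + τ) = fun q => fr.rep σ q + fr.rep τ q := funext (fr.rep_add σ τ)
  ext v
  simp [covAt, repDeriv, h,
    mfderivModel_add (fr.mdifferentiableAt_rep hσ) (fr.mdifferentiableAt_rep hτ)]

lemma covAt_smul_apply {g : N → ℝ} {σ : ∀ x : N, TangentSpace 𝓘(ℝ, F) x} {p : P}
    (hσ : MDifferentiableAt 𝓘(ℝ, F) (𝓘(ℝ, F).prod 𝓘(ℝ, F))
      (fun x => (⟨x, σ x⟩ : TangentBundle 𝓘(ℝ, F) N)) (pr p))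
    (hg : MDifferentiableAt 𝓘(ℝ, F) 𝓘(ℝ, ℝ) g (pr p)) (v : F) :
    fr.covAt (g • σ) p v =
      g (pr p) • fr.covAt σ p v + mfderivModel F ℝ g (pr p) v • fr.frame p (fr.rep σ p) := by
  have h : fr.rep (g • σ) = fun q => g (pr q) • fr.rep σ q := funext (fr.rep_smul g σ)
  obtain ⟨a, rfl⟩ := (fr.isInvertible p).surjective v
  have h1 : mfderivModel E ℝ (fun q => g (pr q)) p (fr.lift p a) =
      mfderivModel F ℝ g (pr p) (fr.frame p a) :=
    congrArg (fun L : E →L[ℝ] ℝ => L (fr.lift p a))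
      (mfderivModel_comp p hg (fr.mdifferentiableAt_proj p))
  have hgπ : MDifferentiableAt 𝓘(ℝ, E) 𝓘(ℝ, ℝ) (fun q => g (pr q)) p :=
    hg.comp p (fr.mdifferentiableAt_proj p)
  rw [covAt_frame, covAt_frame]
  have h2 : fr.repDeriv (g • σ) p a =
      g (pr p) • fr.repDeriv σ p a + mfderivModel F ℝ g (pr p) (fr.frame p a) • fr.rep σ p := by
    change mfderivModel E A (fr.rep (g • σ)) p (fr.lift p a) = _
    rw [h, mfderivModel_smul_apply hgπ (fr.mdifferentiableAt_rep hσ), h1]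
    rfl
  rw [h2, map_add, map_smul, map_smul]

/-- A covariant derivative on `T N` which differentiates the representing functions in horizontal
directions. -/
def IsInduced (cov : CovariantDerivative 𝓘(ℝ, F) F (TangentSpace 𝓘(ℝ, F) : N → Type _)) : Prop :=
  ∀ (σ : ∀ x : N, TangentSpace 𝓘(ℝ, F) x) (p : P),
    MDifferentiableAt 𝓘(ℝ, F) (𝓘(ℝ, F).prod 𝓘(ℝ, F))
      (fun x => (⟨x, σ x⟩ : TangentBundle 𝓘(ℝ, F) N)) (pr p) →
    ∀ a, (cov σ (pr p) : F →L[ℝ] F) (fr.frame p a) = fr.frame p (fr.repDeriv σ p a)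

/-- The covariant derivative on `T N` induced by a horizontal framing. -/
def cov : CovariantDerivative 𝓘(ℝ, F) F (TangentSpace 𝓘(ℝ, F) : N → Type _) where
  -- The point of the fibre is an arbitrary choice. It does not affect the value when `σ` is
  -- differentiable at `x`, which is also where the axioms are imposed and where uniqueness can
  -- hold.
  toFun σ x := fr.covAt σ (Function.surjInv fr.surjective x)
  isCovariantDerivativeOnUniv :=
    { add := by
        intro σ τ x hσ hτ _
        have hx := Function.surjInv_eq fr.surjective x
        exact fr.covAt_add (hx.symm ▸ hσ) (hx.symm ▸ hτ)
      leibniz := by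
        intro σ g x hσ hg _
        have hx := Function.surjInv_eq fr.surjective x
        refine ContinuousLinearMap.ext fun v => ?_
        refine (fr.covAt_smul_apply (hx.symm ▸ hσ) (hx.symm ▸ hg) v).trans ?_
        rw [hx, fr.frame_rep, hx]
        rfl }

lemma cov_eq_covAt {σ : ∀ x : N, TangentSpace 𝓘(ℝ, F) x} {p : P}
    (hσ : MDifferentiableAt 𝓘(ℝ, F) (𝓘(ℝ, F).prod 𝓘(ℝ, F))
      (fun x => (⟨x, σ x⟩ : TangentBundle 𝓘(ℝ, F) N)) (pr p)) :
    (fr.cov σ (pr p) : F →L[ℝ] F) = fr.covAt σ p :=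
  (fr.covAt_eq_of_proj_eq (Function.surjInv_eq fr.surjective _).symm hσ).symm

lemma isInduced_cov : fr.IsInduced fr.cov := fun σ p hσ a =>
  (congrArg (fun L : F →L[ℝ] F => L (fr.frame p a)) (fr.cov_eq_covAt hσ)).trans
    (fr.covAt_frame σ p a)

variable {fr}

omit [FiniteDimensional ℝ A] in
-- The defining formula prescribes the value on every frame vector, and these exhaust the tangent
-- space.
lemma IsInduced.eq {cov cov' : CovariantDerivative 𝓘(ℝ, F) F (TangentSpace 𝓘(ℝ, F) : N → Type _)}
    (h : fr.IsInduced cov) (h' : fr.IsInduced cov')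
    {σ : ∀ x : N, TangentSpace 𝓘(ℝ, F) x} {x : N}
    (hσ : MDifferentiableAt 𝓘(ℝ, F) (𝓘(ℝ, F).prod 𝓘(ℝ, F))
      (fun x => (⟨x, σ x⟩ : TangentBundle 𝓘(ℝ, F) N)) x) : cov σ x = cov' σ x := by
  obtain ⟨p, rfl⟩ := fr.surjective x
  refine ContinuousLinearMap.ext fun v => ?_
  obtain ⟨a, rfl⟩ := (fr.isInvertible p).surjective v
  exact (h σ p hσ a).trans (h' σ p hσ a).symm

variable (fr)

/-- On a fixed vector `a` this is the fibre component of the tangent map of `rep σ` applied to the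
smooth field `lift · a`. -/
lemma contMDiff_repDeriv {σ : ∀ x : N, TangentSpace 𝓘(ℝ, F) x}
    (hσ : ContMDiff 𝓘(ℝ, F) (𝓘(ℝ, F).prod 𝓘(ℝ, F)) ∞
      (fun x => (⟨x, σ x⟩ : TangentBundle 𝓘(ℝ, F) N))) :
    ContMDiff 𝓘(ℝ, E) 𝓘(ℝ, A →L[ℝ] A) ∞ (fr.repDeriv σ) := by
  intro p
  refine contMDiffAt_clm_of_apply fun a => ?_
  have h1 : ContMDiff 𝓘(ℝ, E) 𝓘(ℝ, A) ∞ (fr.rep σ) := fun q => fr.contMDiffAt_rep (hσ (pr q))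
  have h2 := (h1.contMDiff_tangentMap (m := ∞) (by simp)).comp (fr.contMDiff_lift a)
  have h3 := (Bundle.contMDiffAt_totalSpace.1 (h2 p)).2
  simp only [trivializationAt_model_space_apply] at h3
  exact h3

/-- Along a local smooth section `s` of `pr`, the coordinate expression of `∇σ` is `B ∘ D ∘ B⁻¹`
with `B` the frame in coordinates and `D` the horizontal derivative of `rep σ`, both taken at `s x`;
each factor is smooth. -/
lemma contMDiffCovariantDerivative_cov :
    CovariantDerivative.ContMDiffCovariantDerivative fr.cov ∞ := by
  refine ⟨⟨fun {σ} hσ => ?_⟩⟩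
  replace hσ : ContMDiff 𝓘(ℝ, F) (𝓘(ℝ, F).prod 𝓘(ℝ, F)) ∞
      (fun x => (⟨x, σ x⟩ : TangentBundle 𝓘(ℝ, F) N)) := by
    rw [contMDiffOn_univ] at hσ
    exact hσ
  rw [contMDiffOn_univ]
  intro x
  obtain ⟨p, rfl⟩ := fr.surjective x
  obtain ⟨s, hsp, hs, hs'⟩ := fr.exists_section p
  rw [contMDiffAt_hom_bundle]
  refine ⟨contMDiffAt_id, ?_⟩
  have hmem := mem_trivSet (F := F) (pr p)
  have hmem' : pr (s (pr p)) ∈ trivSet (F := F) (pr p) := by rwa [hsp]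
  have hcomp : ContMDiffAt 𝓘(ℝ, F) 𝓘(ℝ, F →L[ℝ] F) ∞
      (fun x => (fr.frameCoord (pr p) (s x)).comp
        ((fr.repDeriv σ (s x)).comp (fr.frameCoord (pr p) (s x)).inverse)) (pr p) :=
    ((fr.contMDiffAt_frameCoord hmem').comp (pr p) hs).clm_comp
      (((fr.contMDiff_repDeriv hσ (s (pr p))).comp (pr p) hs).clm_comp
        ((fr.contMDiffAt_frameCoord_inverse hmem').comp (pr p) hs))
  refine hcomp.congr_of_eventuallyEq ?_
  filter_upwards [hs', (isOpen_trivSet (pr p)).mem_nhds hmem] with x hx hxm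
  have hxm' : pr (s x) ∈ trivSet (F := F) (pr p) := by rwa [hx]
  have h1 : ∀ v : F, (fr.cov σ x : F →L[ℝ] F) v = fr.covAt σ (s x) v := by
    intro v
    have h2 := fr.cov_eq_covAt (p := s x) (σ := σ) (hσ.mdifferentiableAt (by simp))
    rw [hx] at h2
    exact congrArg (fun L : F →L[ℝ] F => L v) h2
  refine ContinuousLinearMap.ext fun v => ?_
  have h3 : ContinuousLinearMap.inCoordinates F (TangentSpace 𝓘(ℝ, F) : N → Type _) F
      (TangentSpace 𝓘(ℝ, F) : N → Type _) (pr p) x (pr p) x (fr.cov σ x) v =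
      trivCoord (F := F) (pr p) x
        ((fr.cov σ x : F →L[ℝ] F) ((trivCoord (F := F) (pr p) x).inverse v)) := by
    rw [ContinuousLinearMap.inCoordinates_eq hxm hxm, trivCoord_inverse hxm]
    exact (trivCoord_apply hxm ((fr.cov σ x : F →L[ℝ] F)
      ((trivializationAt F (TangentSpace 𝓘(ℝ, F) : N → Type _) (pr p)).symm x v))).symm
  refine h3.trans ?_
  rw [h1]
  obtain ⟨a, rfl⟩ := (fr.isInvertible_frameCoord hxm').surjective v
  have h4 : (trivCoord (F := F) (pr p) x).inverse (fr.frameCoord (pr p) (s x) a) =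
      fr.frame (s x) a := by
    rw [frameCoord, hx]
    exact (isInvertible_trivCoord hxm).inverse_apply_self _
  rw [h4, covAt_frame]
  simp only [ContinuousLinearMap.comp_apply,
    (fr.isInvertible_frameCoord hxm').inverse_apply_self]
  simp [frameCoord, hx]

end HorizontalFraming

end FramingConnection

/-! ### Acceleration of projected horizontal curves. -/

section FramingGeodesics

variable {E F A : Type*} [NormedAddCommGroup E] [NormedSpace ℝ E]
    [NormedAddCommGroup F] [NormedSpace ℝ F] [NormedAddCommGroup A] [NormedSpace ℝ A]
    {P : Type*} [TopologicalSpace P] [ChartedSpace E P] [IsManifold 𝓘(ℝ, E) ∞ P]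
    {N : Type*} [TopologicalSpace N] [ChartedSpace F N] [IsManifold 𝓘(ℝ, F) ∞ N] {pr : P → N}

/-- The local vector field which is constant in the trivialization of `T N` at `x₀`. -/
def constField (x₀ : N) (w : F) (x : N) : TangentSpace 𝓘(ℝ, F) x :=
  (trivializationAt F (TangentSpace 𝓘(ℝ, F) : N → Type _) x₀).symm x w

lemma trivCoord_constField {x₀ x : N} (hx : x ∈ trivSet (F := F) x₀) (w : F) :
    trivCoord (F := F) x₀ x (constField x₀ w x) = w := by
  have h : (constField x₀ w x : F) = (trivCoord (F := F) x₀ x).inverse w :=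
    (trivCoord_inverse hx w).symm
  exact (congrArg (trivCoord (F := F) x₀ x) h).trans
    ((isInvertible_trivCoord hx).self_apply_inverse w)

lemma mdifferentiableAt_constField {x₀ : N} (w : F) :
    MDifferentiableAt 𝓘(ℝ, F) (𝓘(ℝ, F).prod 𝓘(ℝ, F))
      (fun x => (⟨x, constField x₀ w x⟩ : TangentBundle 𝓘(ℝ, F) N)) x₀ := by
  refine (mdifferentiableAt_section (IB := 𝓘(ℝ, F)) (F := F)
    (E := (TangentSpace 𝓘(ℝ, F) : N → Type _)) (constField x₀ w)).2 ?_
  refine (mdifferentiableAt_const (c := w)).congr_of_eventuallyEq ?_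
  filter_upwards [(isOpen_trivSet (F := F) x₀).mem_nhds (mem_trivSet x₀)] with x hx
  exact (trivCoord_apply hx (constField x₀ w x)).symm.trans (trivCoord_constField hx w)

namespace HorizontalFraming

variable {fr : HorizontalFraming E F A pr}

omit [IsManifold 𝓘(ℝ, F) ∞ N] in
lemma velocity_eq_frame {γ : ℝ → P} {a : A} {c : ℝ → N} {t : ℝ}
    (hc : c =ᶠ[𝓝 t] fun s => pr (γ s)) (hγ : HasVelocityAt γ (fr.lift (γ t) a) t) :
    HasVelocityAt c (fr.frame (γ t) a) t :=
  (hγ.comp (fr.mdifferentiableAt_proj (γ t))).congr hc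

/-- The acceleration of the projection of a horizontal curve whose velocity is represented by `x`
is represented by the derivative of `x`. -/
lemma IsInduced.covDerivAlong_velocity [FiniteDimensional ℝ A]
    {cov : CovariantDerivative 𝓘(ℝ, F) F (TangentSpace 𝓘(ℝ, F) : N → Type _)}
    (h : fr.IsInduced cov) {γ : ℝ → P} {x : ℝ → A} {c : ℝ → N} {t₀ : ℝ} {x' : A}
    (hc : c =ᶠ[𝓝 t₀] fun t => pr (γ t))
    (hγ : ∀ᶠ t in 𝓝 t₀, HasVelocityAt γ (fr.lift (γ t) (x t)) t)
    (hx : HasDerivAt x x' t₀) :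
    (covDerivAlong cov c (velocity c) t₀ : F) = fr.frame (γ t₀) x' := by
  have hq : c t₀ = pr (γ t₀) := hc.self_of_nhds
  have hγ₀ := hγ.self_of_nhds
  have hvel : ∀ᶠ t in 𝓝 t₀, (velocity c t : F) = fr.frame (γ t) (x t) := by
    filter_upwards [hc.eventually_nhds, hγ] with t h1 h2
    exact (velocity_eq_frame h1 h2).velocity_eq
  have hmem : pr (γ t₀) ∈ trivSet (F := F) (c t₀) := hq ▸ mem_trivSet (c t₀)
  have hmemt : ∀ᶠ t in 𝓝 t₀, pr (γ t) ∈ trivSet (F := F) (c t₀) :=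
    hγ₀.mdifferentiableAt.continuousAt.eventually (fr.preimage_trivSet_mem_nhds hmem)
  -- The frame along `γ`, in the trivialization fixed at time `t₀`. The coordinate of the velocity
  -- is then `v = B x`, and its derivative is `B' x + B x'`.
  let B : ℝ → A →L[ℝ] F := fun t => fr.frameCoord (c t₀) (γ t)
  obtain ⟨B', hB⟩ : ∃ B', HasDerivAt B B' t₀ := by
    have hm : MDifferentiableAt 𝓘(ℝ, E) 𝓘(ℝ, A →L[ℝ] F) (fr.frameCoord (c t₀)) (γ t₀) :=
      (fr.contMDiffAt_frameCoord hmem).mdifferentiableAt (by simp)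
    exact ⟨_, hasVelocityAt_iff_hasDerivAt.1 (hγ₀.comp hm)⟩
  let v : ℝ → F := fun t => (trivializationAt F (TangentSpace 𝓘(ℝ, F) : N → Type _) (c t₀)
    ⟨c t, velocity c t⟩).2
  have hv : v =ᶠ[𝓝 t₀] fun t => B t (x t) := by
    filter_upwards [hvel, hmemt, hc] with t h1 h2 h3
    have h4 : v t = trivCoord (F := F) (c t₀) (c t) (velocity c t : F) :=
      (trivCoord_apply (F := F) (h3 ▸ h2) (velocity c t : F)).symm
    rw [h4]
    refine (congrArg (trivCoord (F := F) (c t₀) (c t)) h1).trans ?_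
    rw [h3]
    rfl
  have hdv : deriv v t₀ = B' (x t₀) + B t₀ x' :=
    ((hB.clm_apply hx).congr_of_eventuallyEq hv).deriv
  let w := v t₀
  have hw : B t₀ (x t₀) = w := hv.self_of_nhds.symm
  let D : A := fr.repDeriv (constField (c t₀) w) (γ t₀) (x t₀)
  have hmdσ : MDifferentiableAt 𝓘(ℝ, F) (𝓘(ℝ, F).prod 𝓘(ℝ, F))
      (fun y => (⟨y, constField (c t₀) w y⟩ : TangentBundle 𝓘(ℝ, F) N)) (pr (γ t₀)) :=
    hq ▸ mdifferentiableAt_constField (F := F) w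
  -- The function representing the constant field `w`, taken along `γ`; its derivative is the vector
  -- `D` that represents the covariant derivative of that field.
  let y : ℝ → A := fun t => fr.rep (constField (c t₀) w) (γ t)
  have hy : HasDerivAt y D t₀ :=
    hasVelocityAt_iff_hasDerivAt.1 (hγ₀.comp (fr.mdifferentiableAt_rep hmdσ))
  have hBy : ∀ᶠ t in 𝓝 t₀, B t (y t) = w := by
    filter_upwards [hmemt] with t ht
    change trivCoord (F := F) (c t₀) (pr (γ t)) (fr.frame (γ t) (fr.rep _ (γ t))) = w
    rw [fr.frame_rep]
    exact trivCoord_constField ht w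
  have hy0 : y t₀ = x t₀ :=
    (fr.isInvertible_frameCoord hmem).injective (hBy.self_of_nhds.trans hw.symm)
  -- Derivative of the constant `B y = w`, using `y t₀ = x t₀`. The Christoffel term `B D` thus
  -- cancels `B' x`, leaving `B x'`.
  have hsum : B' (x t₀) + B t₀ D = 0 := by
    have h1 := hB.clm_apply hy
    rw [hy0] at h1
    exact h1.unique ((hasDerivAt_const t₀ w).congr_of_eventuallyEq hBy)
  have hcov : (cov (constField (c t₀) w) (c t₀) : F →L[ℝ] F) (velocity c t₀ : F) =
      fr.frame (γ t₀) D := by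
    have h1 : ∀ z, z = pr (γ t₀) → (cov (constField (c t₀) w) z : F →L[ℝ] F)
        (fr.frame (γ t₀) (x t₀)) = fr.frame (γ t₀) D := by
      rintro _ rfl
      exact h _ _ hmdσ (x t₀)
    exact (congrArg (cov (constField (c t₀) w) (c t₀) : F →L[ℝ] F) hvel.self_of_nhds).trans
      (h1 _ hq)
  have hfr : ∀ a, fr.frame (γ t₀) a = (trivCoord (F := F) (c t₀) (c t₀)).inverse (B t₀ a) := by
    intro a
    refine ((isInvertible_trivCoord (mem_trivSet (c t₀))).inverse_apply_eq.2 ?_).symm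
    change trivCoord (F := F) (c t₀) (pr (γ t₀)) _ = _
    rw [← hq]
    rfl
  have hsymm : ((trivializationAt F (TangentSpace 𝓘(ℝ, F) : N → Type _) (c t₀)).symm (c t₀)
      (deriv v t₀) : F) = (trivCoord (F := F) (c t₀) (c t₀)).inverse (deriv v t₀) :=
    (trivCoord_inverse (F := F) (mem_trivSet (c t₀)) _).symm
  refine (congrArg₂ (fun a b : F => a + b) hsymm hcov).trans ?_
  rw [hdv, hfr D, hfr x', ← map_add]
  congr 1
  rw [add_right_comm, hsum, zero_add]

end HorizontalFraming

end FramingGeodesics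

/-! ### Charts along curves and regularity of integral curves. -/

section Curves

lemma eventually_eq_of_eventually_hasDerivAt_zero {A : Type*} [NormedAddCommGroup A]
    [NormedSpace ℝ A] {f : ℝ → A} {t₀ : ℝ} (h : ∀ᶠ t in 𝓝 t₀, HasDerivAt f 0 t) :
    ∀ᶠ t in 𝓝 t₀, f t = f t₀ := by
  obtain ⟨ε, hε, hb⟩ := Metric.eventually_nhds_iff_ball.1 h
  filter_upwards [Metric.ball_mem_nhds t₀ hε] with t ht
  exact Metric.isOpen_ball.is_const_of_deriv_eq_zero (convex_ball t₀ ε).isPreconnected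
    (fun s hs => (hb s hs).differentiableAt.differentiableWithinAt)
    (fun s hs => (hb s hs).deriv) ht (Metric.mem_ball_self hε)

variable {F : Type*} [NormedAddCommGroup F] [NormedSpace ℝ F]
  {N : Type*} [TopologicalSpace N] [ChartedSpace F N] [IsManifold 𝓘(ℝ, F) ∞ N]

lemma trivCoord_eq_mfderivModel {x₀ x : N} (hx : x ∈ trivSet (F := F) x₀) :
    trivCoord (F := F) x₀ x = mfderivModel F F (extChartAt 𝓘(ℝ, F) x₀) x :=
  TangentBundle.continuousLinearMapAt_trivializationAt hx

lemma contMDiffAt_extChartAt_of_mem {x₀ x : N} (hx : x ∈ trivSet (F := F) x₀) :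
    ContMDiffAt 𝓘(ℝ, F) 𝓘(ℝ, F) ∞ (extChartAt 𝓘(ℝ, F) x₀) x :=
  contMDiffAt_extChartAt' hx

lemma HasVelocityAt.hasDerivAt_extChartAt {γ : ℝ → N} {v : F} {t : ℝ} {x₀ : N}
    (h : HasVelocityAt γ v t) (hx : γ t ∈ trivSet (F := F) x₀) :
    HasDerivAt (fun s => extChartAt 𝓘(ℝ, F) x₀ (γ s)) (trivCoord x₀ (γ t) v) t := by
  rw [trivCoord_eq_mfderivModel hx]
  exact hasVelocityAt_iff_hasDerivAt.1
    (h.comp ((contMDiffAt_extChartAt_of_mem hx).mdifferentiableAt (by simp)))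

/-- Integral curves of smooth vector fields are smooth. -/
lemma contMDiffAt_of_hasVelocityAt {V : N → F}
    (hV : ContMDiff 𝓘(ℝ, F) (𝓘(ℝ, F).prod 𝓘(ℝ, F)) ∞
      (fun x => (⟨x, V x⟩ : TangentBundle 𝓘(ℝ, F) N))) {γ : ℝ → N} {t₀ : ℝ}
    (h : ∀ᶠ t in 𝓝 t₀, HasVelocityAt γ (V (γ t)) t) :
    ContMDiffAt 𝓘(ℝ, ℝ) 𝓘(ℝ, F) ∞ γ t₀ := by
  set x₀ := γ t₀ with hx₀
  have hcont : ContinuousAt γ t₀ := h.self_of_nhds.mdifferentiableAt.continuousAt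
  have hmem : ∀ᶠ t in 𝓝 t₀, γ t ∈ trivSet (F := F) x₀ :=
    hcont.eventually ((isOpen_trivSet x₀).mem_nhds (mem_trivSet x₀))
  obtain ⟨ε, hε, hb⟩ := Metric.eventually_nhds_iff_ball.1 (h.and hmem)
  set B := Metric.ball t₀ ε
  have hB : IsOpen B := Metric.isOpen_ball
  let u : ℝ → F := fun t => extChartAt 𝓘(ℝ, F) x₀ (γ t)
  let g : N → F := fun x => (trivializationAt F (TangentSpace 𝓘(ℝ, F) : N → Type _) x₀ ⟨x, V x⟩).2
  have hg : ∀ x ∈ trivSet (F := F) x₀, ContMDiffAt 𝓘(ℝ, F) 𝓘(ℝ, F) ∞ g x := fun x hx =>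
    (((trivializationAt F (TangentSpace 𝓘(ℝ, F) : N → Type _) x₀).contMDiffAt_iff
      (n := ∞) (IM := 𝓘(ℝ, F)) (IB := 𝓘(ℝ, F))
      (f := fun q => (⟨q, V q⟩ : TangentBundle 𝓘(ℝ, F) N)) (x₀ := x)
      ((Bundle.Trivialization.mem_source _).2 hx)).1 (hV x)).2
  have hu : ∀ t ∈ B, HasDerivAt u (g (γ t)) t := by
    intro t ht
    have h1 := (hb t ht).1.hasDerivAt_extChartAt (hb t ht).2
    rw [trivCoord_apply (hb t ht).2] at h1
    exact h1
  -- Bootstrapping: in the chart `u' = g ∘ γ`, so `γ` of class `C^n` gives `u` of class `C^(n+1)`,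
  -- and the inverse chart returns this to `γ`.
  have key : ∀ n : ℕ, ContMDiffOn 𝓘(ℝ, ℝ) 𝓘(ℝ, F) n γ B := by
    intro n
    induction n with
    | zero =>
      exact contMDiffOn_zero_iff.2
        fun t ht => (hb t ht).1.mdifferentiableAt.continuousAt.continuousWithinAt
    | succ n ih =>
      have hd : ContDiffOn ℝ n (deriv u) B := by
        refine ContDiffOn.congr ?_ fun t ht => (hu t ht).deriv
        refine contMDiffOn_iff_contDiffOn.1 fun t ht => ?_
        exact ((hg _ (hb t ht).2).of_le (by exact_mod_cast le_top)).comp_contMDiffWithinAt t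
          (ih t ht)
      have hu' : ContDiffOn ℝ (n + 1) u B := (contDiffOn_succ_iff_deriv_of_isOpen hB).2
        ⟨fun t ht => (hu t ht).differentiableAt.differentiableWithinAt, by simp, hd⟩
      have hs : ContMDiffOn 𝓘(ℝ, F) 𝓘(ℝ, F) (n + 1) (extChartAt 𝓘(ℝ, F) x₀).symm
          (extChartAt 𝓘(ℝ, F) x₀).target :=
        (contMDiffOn_extChartAt_symm (n := ∞) x₀).of_le (by exact_mod_cast le_top)
      have hmt : ∀ t ∈ B, γ t ∈ (extChartAt 𝓘(ℝ, F) x₀).source := by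
        intro t ht
        rw [extChartAt_source]
        exact (hb t ht).2
      have := hs.comp hu'.contMDiffOn fun t ht => (extChartAt 𝓘(ℝ, F) x₀).map_source (hmt t ht)
      exact this.congr fun t ht => ((extChartAt 𝓘(ℝ, F) x₀).left_inv (hmt t ht)).symm
  exact (contMDiffOn_infty.2 key).contMDiffAt (hB.mem_nhds (Metric.mem_ball_self hε))

end Curves

/-! ### Horizontal lifts of curves and of geodesics. -/

section HorizontalLift

variable {E F A : Type*} [NormedAddCommGroup E] [NormedSpace ℝ E] [CompleteSpace E]
    [NormedAddCommGroup F] [NormedSpace ℝ F] [NormedAddCommGroup A] [NormedSpace ℝ A]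
    [FiniteDimensional ℝ A]
    {P : Type*} [TopologicalSpace P] [ChartedSpace E P] [IsManifold 𝓘(ℝ, E) ∞ P]
    {N : Type*} [TopologicalSpace N] [ChartedSpace F N] [IsManifold 𝓘(ℝ, F) ∞ N] {pr : P → N}

namespace HorizontalFraming

variable (fr : HorizontalFraming E F A pr)

omit [IsManifold 𝓘(ℝ, F) ∞ N] in
/-- Solutions of time-dependent horizontal differential equations. -/
lemma exists_horizontal_solution {X : P × ℝ → A} {p₀ : P} {t₀ : ℝ}
    (hX : ContMDiffAt (𝓘(ℝ, E).prod 𝓘(ℝ, ℝ)) 𝓘(ℝ, A) ∞ X (p₀, t₀)) :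
    ∃ γ : ℝ → P, γ t₀ = p₀ ∧
      ∀ᶠ t in 𝓝 t₀, HasVelocityAt γ (fr.lift (γ t) (X (γ t, t))) t := by
  -- Adding time as a coordinate of unit speed makes the equation autonomous on `P × ℝ`.
  let W : ∀ q : P × ℝ, TangentSpace (𝓘(ℝ, E).prod 𝓘(ℝ, ℝ)) q :=
    fun q => ((fr.lift q.1 (X q), (1 : ℝ)) : E × ℝ)
  have h1 : ContMDiffAt (𝓘(ℝ, E).prod 𝓘(ℝ, ℝ)) 𝓘(ℝ, E).tangent ∞
      (fun q : P × ℝ => (⟨q.1, fr.lift q.1 (X q)⟩ : TangentBundle 𝓘(ℝ, E) P)) (p₀, t₀) :=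
    contMDiffAt_tangent_apply (f := fun p : P => p) (L := fr.lift)
      (fun a => fr.contMDiff_lift a _) contMDiffAt_fst hX
  have h2 : ContMDiffAt (𝓘(ℝ, E).prod 𝓘(ℝ, ℝ)) 𝓘(ℝ, ℝ).tangent ∞
      (fun q : P × ℝ => (⟨q.2, (1 : ℝ)⟩ : TangentBundle 𝓘(ℝ, ℝ) ℝ)) (p₀, t₀) := by
    refine Bundle.contMDiffAt_totalSpace.2 ⟨contMDiffAt_snd, ?_⟩
    simp only [trivializationAt_model_space_apply]
    exact contMDiffAt_const
  have hW : ContMDiffAt (𝓘(ℝ, E).prod 𝓘(ℝ, ℝ)) (𝓘(ℝ, E).prod 𝓘(ℝ, ℝ)).tangent 1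
      (fun q => (⟨q, W q⟩ : TangentBundle (𝓘(ℝ, E).prod 𝓘(ℝ, ℝ)) (P × ℝ))) (p₀, t₀) :=
    ((contMDiff_equivTangentBundleProd_symm (n := ∞) (I := 𝓘(ℝ, E)) (M := P)
      (I' := 𝓘(ℝ, ℝ)) (M' := ℝ)).contMDiffAt.comp (p₀, t₀) (h1.prodMk h2)).of_le (by simp)
  obtain ⟨Γ, hΓ₀, hΓ⟩ := exists_isMIntegralCurveAt_of_contMDiffAt_boundaryless t₀ hW
  have hΓ1 : ∀ᶠ t in 𝓝 t₀, HasVelocityAt (fun s => (Γ s).1) (fr.lift (Γ t).1 (X (Γ t))) t := by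
    filter_upwards [hΓ] with t ht
    refine ((hasMFDerivAt_fst (I := 𝓘(ℝ, E)) (I' := 𝓘(ℝ, ℝ)) (Γ t)).comp t ht).congr_mfderiv ?_
    exact ContinuousLinearMap.ext fun r => rfl
  have hΓ2 : ∀ᶠ t in 𝓝 t₀, HasDerivAt (fun s => (Γ s).2) 1 t := by
    filter_upwards [hΓ] with t ht
    refine hasVelocityAt_iff_hasDerivAt.1 ?_
    refine ((hasMFDerivAt_snd (I := 𝓘(ℝ, E)) (I' := 𝓘(ℝ, ℝ)) (Γ t)).comp t ht).congr_mfderiv ?_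
    exact ContinuousLinearMap.ext fun r => rfl
  -- The time coordinate starts at `t₀` with unit speed, so it equals `t` near `t₀`.
  have h3 : ∀ᶠ t in 𝓝 t₀, HasDerivAt (fun s => (Γ s).2 - s) 0 t := by
    filter_upwards [hΓ2] with t ht
    exact (ht.sub (hasDerivAt_id t)).congr_deriv (sub_self 1)
  refine ⟨fun t => (Γ t).1, congrArg Prod.fst hΓ₀, ?_⟩
  filter_upwards [hΓ1, eventually_eq_of_eventually_hasDerivAt_zero h3] with t h4 h5
  rw [hΓ₀, sub_self, sub_eq_zero] at h5
  have h6 : ((Γ t).1, t) = Γ t := Prod.ext rfl h5.symm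
  rwa [h6]

/-- Local horizontal lifts of smooth curves. -/
lemma exists_horizontal_lift {c : ℝ → N} {t₀ : ℝ}
    (hc : ∀ᶠ t in 𝓝 t₀, ContMDiffAt 𝓘(ℝ, ℝ) 𝓘(ℝ, F) ∞ c t) {p₀ : P} (hp₀ : pr p₀ = c t₀) :
    ∃ (γ : ℝ → P) (x : ℝ → A), γ t₀ = p₀ ∧ (∀ᶠ t in 𝓝 t₀, c t = pr (γ t)) ∧
      (∀ᶠ t in 𝓝 t₀, HasVelocityAt γ (fr.lift (γ t) (x t)) t) ∧
      ∀ᶠ t in 𝓝 t₀, DifferentiableAt ℝ x t := by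
  have hcmem : ∀ᶠ t in 𝓝 t₀, c t ∈ trivSet (F := F) (c t₀) :=
    hc.self_of_nhds.continuousAt.eventually ((isOpen_trivSet _).mem_nhds (mem_trivSet _))
  obtain ⟨v, hvc⟩ : ∃ v : ℝ → F, v = fun t => extChartAt 𝓘(ℝ, F) (c t₀) (c t) := ⟨_, rfl⟩
  have hv : ∀ᶠ t in 𝓝 t₀, ContDiffAt ℝ ∞ v t := by
    filter_upwards [hc, hcmem] with t h1 h2
    rw [hvc]
    have h3 : ContMDiffAt 𝓘(ℝ, ℝ) 𝓘(ℝ, F) ∞ (fun t => extChartAt 𝓘(ℝ, F) (c t₀) (c t)) t :=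
      ContMDiffAt.comp t (contMDiffAt_extChartAt_of_mem h2) h1
    exact h3.contDiffAt
  have hν : ∀ᶠ t in 𝓝 t₀, ContDiffAt ℝ ∞ (deriv v) t := by
    filter_upwards [hv] with t ht
    have h1 : deriv v = fun s => fderiv ℝ v s 1 := funext fun s => fderiv_apply_one_eq_deriv.symm
    rw [h1]
    exact (ht.fderiv_right (m := ∞) (by simp)).clm_apply contDiffAt_const
  have hmem₀ : pr p₀ ∈ trivSet (F := F) (c t₀) := by
    rw [hp₀]
    exact mem_trivSet (c t₀)
  have h1 : ContMDiffAt (𝓘(ℝ, E).prod 𝓘(ℝ, ℝ)) 𝓘(ℝ, F →L[ℝ] A) ∞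
      (fun q : P × ℝ => (fr.frameCoord (c t₀) q.1).inverse) (p₀, t₀) :=
    ContMDiffAt.comp (p₀, t₀) (fr.contMDiffAt_frameCoord_inverse hmem₀) contMDiffAt_fst
  have h2 : ContMDiffAt (𝓘(ℝ, E).prod 𝓘(ℝ, ℝ)) 𝓘(ℝ, F) ∞
      (fun q : P × ℝ => deriv v q.2) (p₀, t₀) :=
    ContMDiffAt.comp (p₀, t₀) hν.self_of_nhds.contMDiffAt contMDiffAt_snd
  -- The direction `B⁻¹ v'` is chosen so that the projected solution has chart velocity `v'`. It
  -- then has the same chart derivative and initial point as `c`.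
  obtain ⟨γ, hγ₀, hγv⟩ := fr.exists_horizontal_solution (h1.clm_apply h2)
  have hγmem : ∀ᶠ t in 𝓝 t₀, pr (γ t) ∈ trivSet (F := F) (c t₀) :=
    hγv.self_of_nhds.mdifferentiableAt.continuousAt.eventually
      (fr.preimage_trivSet_mem_nhds (by rwa [hγ₀]))
  refine ⟨γ, fun t => (fr.frameCoord (c t₀) (γ t)).inverse (deriv v t), hγ₀, ?_, hγv, ?_⟩
  · have hd : ∀ᶠ t in 𝓝 t₀, HasDerivAt
        (fun s => extChartAt 𝓘(ℝ, F) (c t₀) (pr (γ s)) - v s) 0 t := by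
      filter_upwards [hγv, hγmem, hv] with t h1 h2 h3
      have h4 := (h1.comp (fr.mdifferentiableAt_proj _)).hasDerivAt_extChartAt h2
      have h5 := h4.sub (h3.differentiableAt (by simp)).hasDerivAt
      refine h5.congr_deriv (sub_eq_zero.2 ?_)
      exact (fr.isInvertible_frameCoord h2).self_apply_inverse _
    filter_upwards [eventually_eq_of_eventually_hasDerivAt_zero hd, hγmem, hcmem] with t h1 h2 h3
    have h4 : extChartAt 𝓘(ℝ, F) (c t₀) (pr (γ t)) - v t = 0 := by
      rw [h1, hγ₀, hp₀, hvc]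
      exact sub_self _
    rw [hvc] at h4
    refine (extChartAt 𝓘(ℝ, F) (c t₀)).injOn ?_ ?_ (sub_eq_zero.1 h4).symm <;>
    rwa [extChartAt_source]
  · filter_upwards [hγv, hγmem, hν] with t h1 h2 h3
    have h4 := hasVelocityAt_iff_hasDerivAt.1 (h1.comp (f := fun p =>
      (fr.frameCoord (c t₀) p).inverse)
      ((fr.contMDiffAt_frameCoord_inverse h2).mdifferentiableAt (by simp)))
    exact (h4.clm_apply (h3.differentiableAt (by simp)).hasDerivAt).differentiableAt

variable {fr}

/-- Locally, geodesics are projections of horizontal curves of constant direction. -/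
lemma IsInduced.exists_lift_of_geodesic
    {cov : CovariantDerivative 𝓘(ℝ, F) F (TangentSpace 𝓘(ℝ, F) : N → Type _)}
    (h : fr.IsInduced cov) {c : ℝ → N} {J : Set ℝ} (hJ : IsOpen J) (hc : IsGeodesicOn cov c J)
    {t₀ : ℝ} (ht₀ : t₀ ∈ J) {p₀ : P} (hp₀ : pr p₀ = c t₀) :
    ∃ (γ : ℝ → P) (a : A), γ t₀ = p₀ ∧ (∀ᶠ t in 𝓝 t₀, c t = pr (γ t)) ∧
      ∀ᶠ t in 𝓝 t₀, HasVelocityAt γ (fr.lift (γ t) a) t := by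
  have hJ₀ : ∀ᶠ t in 𝓝 t₀, t ∈ J := hJ.mem_nhds ht₀
  obtain ⟨γ, x, hγ₀, hcγ, hγ, hx⟩ := fr.exists_horizontal_lift (c := c) (t₀ := t₀) (p₀ := p₀)
    (hJ₀.mono fun t ht => hc.1.contMDiffAt (hJ.mem_nhds ht)) hp₀
  refine ⟨γ, x t₀, hγ₀, hcγ, ?_⟩
  -- Zero acceleration means `frame (γ t) (x' t) = 0`, and the frame is injective.
  have hx' : ∀ᶠ t in 𝓝 t₀, HasDerivAt x 0 t := by
    filter_upwards [hJ₀, hcγ.eventually_nhds, hγ.eventually_nhds, hx] with t h1 h2 h3 h4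
    have h5 := h.covDerivAlong_velocity h2 h3 h4.hasDerivAt
    have h6 : fr.frame (γ t) (deriv x t) = 0 := h5.symm.trans (hc.2 t h1)
    have h7 : deriv x t = 0 := (fr.isInvertible (γ t)).injective (h6.trans (map_zero _).symm)
    exact h7 ▸ h4.hasDerivAt
  filter_upwards [hγ, eventually_eq_of_eventually_hasDerivAt_zero hx'] with t h1 h2
  rwa [h2] at h1

omit [CompleteSpace E] in
-- A constant direction has derivative zero, so the acceleration vanishes. Smoothness, which is part
-- of being a geodesic, comes from regularity of integral curves.
lemma IsInduced.isGeodesicOn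
    {cov : CovariantDerivative 𝓘(ℝ, F) F (TangentSpace 𝓘(ℝ, F) : N → Type _)}
    (h : fr.IsInduced cov) {c : ℝ → N} {J : Set ℝ} (hJ : IsOpen J) {γ : ℝ → P} {a : A}
    (hγ : ∀ t ∈ J, HasVelocityAt γ (fr.lift (γ t) a) t) (hc : ∀ t ∈ J, c t = pr (γ t)) :
    IsGeodesicOn cov c J := by
  have hγ' : ∀ t ∈ J, ∀ᶠ s in 𝓝 t, HasVelocityAt γ (fr.lift (γ s) a) s :=
    fun t ht => Filter.mem_of_superset (hJ.mem_nhds ht) hγ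
  have hc' : ∀ t ∈ J, c =ᶠ[𝓝 t] fun s => pr (γ s) :=
    fun t ht => Filter.mem_of_superset (hJ.mem_nhds ht) hc
  refine ⟨fun t ht => ?_, fun t ht => ?_⟩
  · have h1 := contMDiffAt_of_hasVelocityAt (fr.contMDiff_lift a) (hγ' t ht)
    exact (((fr.contMDiff_proj (γ t)).comp t h1).congr_of_eventuallyEq
      (hc' t ht)).contMDiffWithinAt
  · refine (h.covDerivAlong_velocity (x := fun _ => a) (hc' t ht) (hγ' t ht)
      (hasDerivAt_const t a)).trans ?_
    exact map_zero (fr.frame (γ t))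

end HorizontalFraming

end HorizontalLift

/-! ### Local sections and vertical curves of submersions. -/

section Submersions

variable {E F K : Type*} [NormedAddCommGroup E] [NormedSpace ℝ E]
    [NormedAddCommGroup F] [NormedSpace ℝ F] [NormedAddCommGroup K] [NormedSpace ℝ K]
    {P : Type*} [TopologicalSpace P] [ChartedSpace E P]
    {N : Type*} [TopologicalSpace N] [ChartedSpace F N]
    {pr : P → N} {p : P}

/-- A submersion is, in suitable charts, a linear projection. -/
lemma exists_charts_of_isSubmersionAt
    (h : Manifold.IsSubmersionAtOfComplement K 𝓘(ℝ, E) 𝓘(ℝ, F) ∞ pr p) :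
    ∃ (φ : OpenPartialHomeomorph P E) (ψ : OpenPartialHomeomorph N F) (L : E ≃L[ℝ] F × K),
      p ∈ φ.source ∧ pr p ∈ ψ.source ∧ (∀ q ∈ φ.source, pr q ∈ ψ.source) ∧
      (∀ q ∈ φ.source, ψ (pr q) = (L (φ q)).1) ∧
      φ ∈ IsManifold.maximalAtlas 𝓘(ℝ, E) ∞ P ∧ ψ ∈ IsManifold.maximalAtlas 𝓘(ℝ, F) ∞ N := by
  refine ⟨h.domChart, h.codChart, h.equiv, h.mem_domChart_source, h.mem_codChart_source,
    h.source_subset_preimage_source, fun q hq => ?_, h.domChart_mem_maximalAtlas,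
    h.codChart_mem_maximalAtlas⟩
  have h1 := h.writtenInCharts (show h.domChart q ∈ (h.domChart.extend 𝓘(ℝ, E)).target by
    simpa using h.domChart.map_source hq)
  simpa [h.domChart.left_inv hq] using h1

/-- In adapted charts the submersion is the projection `F × K → F`; freezing the `K`-coordinate at
its value at `p` gives the section. -/
lemma exists_section_of_isSubmersionAt
    (h : Manifold.IsSubmersionAtOfComplement K 𝓘(ℝ, E) 𝓘(ℝ, F) ∞ pr p) :
    ∃ s : N → P, s (pr p) = p ∧ ContMDiffAt 𝓘(ℝ, F) 𝓘(ℝ, E) ∞ s (pr p) ∧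
      ∀ᶠ x in 𝓝 (pr p), pr (s x) = x := by
  obtain ⟨φ, ψ, L, hp, hprp, hmaps, hL, hφ, hψ⟩ := exists_charts_of_isSubmersionAt h
  let j : N → E := fun x => L.symm (ψ x, (L (φ p)).2)
  have hj₀ : j (pr p) = φ p := by
    simp only [j, hL p hp]
    exact L.symm_apply_apply _
  have hψs : ContMDiffAt 𝓘(ℝ, F) 𝓘(ℝ, F) ∞ ψ (pr p) :=
    (contMDiffOn_of_mem_maximalAtlas hψ).contMDiffAt (ψ.open_source.mem_nhds hprp)
  have hj : ContMDiffAt 𝓘(ℝ, F) 𝓘(ℝ, E) ∞ j (pr p) :=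
    (L.symm.contDiff (n := ∞)).contMDiff.contMDiffAt.comp (pr p) (hψs.prodMk_space contMDiffAt_const)
  have hφs : ContMDiffAt 𝓘(ℝ, E) 𝓘(ℝ, E) ∞ φ.symm (j (pr p)) := by
    rw [hj₀]
    exact (contMDiffOn_symm_of_mem_maximalAtlas hφ).contMDiffAt
      (φ.open_target.mem_nhds (φ.map_source hp))
  refine ⟨fun x => φ.symm (j x), by simp only [hj₀, φ.left_inv hp], hφs.comp (pr p) hj, ?_⟩
  have hjt : ∀ᶠ x in 𝓝 (pr p), j x ∈ φ.target :=
    hj.continuousAt.eventually (φ.open_target.mem_nhds (hj₀ ▸ φ.map_source hp))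
  filter_upwards [hjt, ψ.open_source.mem_nhds hprp] with x h1 h2
  have h3 := φ.map_target h1
  refine ψ.injOn (hmaps _ h3) h2 ?_
  rw [hL _ h3, φ.right_inv h1]
  simp [j]

/-- The derivative of a local section is a right inverse of the derivative of `pr`. -/
lemma surjective_mfderivModel_of_isSubmersionAt
    (h : Manifold.IsSubmersionAtOfComplement K 𝓘(ℝ, E) 𝓘(ℝ, F) ∞ pr p) :
    Function.Surjective (mfderivModel E F pr p) := by
  obtain ⟨s, hs₀, hs, hs'⟩ := exists_section_of_isSubmersionAt h
  have hpr : MDifferentiableAt 𝓘(ℝ, E) 𝓘(ℝ, F) pr (s (pr p)) := by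
    rw [hs₀]
    exact h.contMDiffAt.mdifferentiableAt (by simp)
  have h1 := mfderivModel_comp (pr p) hpr (hs.mdifferentiableAt (by simp))
  have h2 : (fun x => pr (s x)) =ᶠ[𝓝 (pr p)] fun x => x := hs'
  rw [mfderivModel_congr h2, mfderivModel_id, hs₀] at h1
  intro v
  exact ⟨mfderivModel F E s (pr p) v, (congrArg (fun L : F →L[ℝ] F => L v) h1).symm⟩

/-- Vertical vectors of a submersion are velocities of smooth curves in the fibre. -/
lemma exists_vertical_curve
    (h : Manifold.IsSubmersionAtOfComplement K 𝓘(ℝ, E) 𝓘(ℝ, F) ∞ pr p) {v : E}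
    (hv : mfderivModel E F pr p v = 0) :
    ∃ γ : ℝ → P, ContMDiff 𝓘(ℝ, ℝ) 𝓘(ℝ, E) ∞ γ ∧ γ 0 = p ∧ HasVelocityAt γ v 0 ∧
      ∀ t, pr (γ t) = pr p := by
  obtain ⟨φ, ψ, L, hp, hprp, hmaps, hL, hφ, hψ⟩ := exists_charts_of_isSubmersionAt h
  have hφm : MDifferentiableAt 𝓘(ℝ, E) 𝓘(ℝ, E) φ p :=
    ((contMDiffOn_of_mem_maximalAtlas hφ).contMDiffAt
      (φ.open_source.mem_nhds hp)).mdifferentiableAt (by simp)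
  have hψm : MDifferentiableAt 𝓘(ℝ, F) 𝓘(ℝ, F) ψ (pr p) :=
    ((contMDiffOn_of_mem_maximalAtlas hψ).contMDiffAt
      (ψ.open_source.mem_nhds hprp)).mdifferentiableAt (by simp)
  have hφs : ∀ y ∈ φ.target, ContMDiffAt 𝓘(ℝ, E) 𝓘(ℝ, E) ∞ φ.symm y := fun y hy =>
    (contMDiffOn_symm_of_mem_maximalAtlas hφ).contMDiffAt (φ.open_target.mem_nhds hy)
  have hφp := φ.map_source hp
  obtain ⟨w, hw⟩ : ∃ w, w = mfderivModel E E φ p v := ⟨_, rfl⟩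
  have hLw : (L w).1 = 0 := by
    have h1 := mfderivModel_comp p hψm (h.contMDiffAt.mdifferentiableAt (by simp))
    have hLm : MDifferentiableAt 𝓘(ℝ, E) 𝓘(ℝ, F) (fun y => (L y).1) (φ p) :=
      (L.differentiableAt.fst).mdifferentiableAt
    have h2 := mfderivModel_comp p hLm hφm
    have h3 : (fun q => ψ (pr q)) =ᶠ[𝓝 p] fun q => (L (φ q)).1 :=
      Filter.mem_of_superset (φ.open_source.mem_nhds hp) hL
    rw [mfderivModel_congr h3, h2, mfderivModel_eq_fderiv] at h1
    have h4 : fderiv ℝ (fun y => (L y).1) (φ p) =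
        (ContinuousLinearMap.fst ℝ F K).comp (L : E →L[ℝ] F × K) :=
      ((ContinuousLinearMap.fst ℝ F K).comp (L : E →L[ℝ] F × K)).hasFDerivAt.fderiv
    rw [h4] at h1
    have h5 := congrArg (fun A : E →L[ℝ] F => A v) h1
    simp only [ContinuousLinearMap.comp_apply, hv, map_zero, ← hw] at h5
    exact h5
  have hsw : mfderivModel E E φ.symm (φ p) w = v := by
    have h1 := mfderivModel_comp p ((hφs _ hφp).mdifferentiableAt (by simp)) hφm
    have h2 : (fun q => φ.symm (φ q)) =ᶠ[𝓝 p] fun q => q :=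
      Filter.mem_of_superset (φ.open_source.mem_nhds hp) fun q hq => φ.left_inv hq
    rw [mfderivModel_congr h2, mfderivModel_id] at h1
    rw [hw]
    exact (congrArg (fun A : E →L[ℝ] E => A v) h1).symm
  obtain ⟨δ, hδ, hball⟩ := Metric.isOpen_iff.1 φ.open_target (φ p) hφp
  obtain ⟨ε, hε, hεw⟩ : ∃ ε : ℝ, 0 < ε ∧ ε * ‖w‖ < δ := by
    refine ⟨δ / (‖w‖ + 1), by positivity, ?_⟩
    rw [div_mul_eq_mul_div, div_lt_iff₀ (by positivity)]
    nlinarith [norm_nonneg w]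
  -- The line through `φ p` may leave the chart. Since `ε sin(t/ε)` is bounded by `ε` and has
  -- derivative `1` at `0`, it gives a curve defined for all times that stays in the ball. It moves
  -- only in the `K`-directions because `(L w).1 = 0`.
  let u : ℝ → E := fun t => φ p + (ε * Real.sin (t / ε)) • w
  have hu : ContDiff ℝ ∞ u := by fun_prop
  have hut : ∀ t, u t ∈ φ.target := by
    intro t
    refine hball ?_
    rw [Metric.mem_ball, dist_eq_norm]
    simp only [u, add_sub_cancel_left, norm_smul, norm_mul, Real.norm_eq_abs, abs_of_pos hε]
    refine lt_of_le_of_lt ?_ hεw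
    refine mul_le_mul_of_nonneg_right ?_ (norm_nonneg w)
    exact mul_le_of_le_one_right hε.le (Real.abs_sin_le_one _)
  have hu0 : u 0 = φ p := by simp [u]
  have hu' : HasDerivAt u w 0 := by
    have h1 : HasDerivAt (fun t : ℝ => ε * Real.sin (t / ε)) 1 0 := by
      have h2 := (((hasDerivAt_id (0 : ℝ)).div_const ε).sin).const_mul ε
      refine h2.congr_deriv ?_
      simp [hε.ne']
    exact ((h1.smul_const w).const_add (φ p)).congr_deriv (one_smul ℝ w)
  refine ⟨fun t => φ.symm (u t), fun t => (hφs _ (hut t)).comp t hu.contMDiff.contMDiffAt, ?_, ?_,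
    fun t => ?_⟩
  · simp only [hu0, φ.left_inv hp]
  · have h1 := (hasVelocityAt_iff_hasDerivAt.2 hu').comp
      ((hφs _ (hut 0)).mdifferentiableAt (by simp))
    rwa [hu0, hsw] at h1
  · have h3 := φ.map_target (hut t)
    refine ψ.injOn (hmaps _ h3) hprp ?_
    rw [hL _ h3, φ.right_inv (hut t), hL p hp]
    simp [u, hLw]

end Submersions

/-! ### Left translations and the two framings. -/

section LieGroup

variable {E : Type*} [NormedAddCommGroup E] [NormedSpace ℝ E]
  {G : Type*} [TopologicalSpace G] [ChartedSpace E G] [Group G] [LieGroup 𝓘(ℝ, E) ∞ G]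

lemma mdifferentiableAt_mul_left (g x : G) :
    MDifferentiableAt 𝓘(ℝ, E) 𝓘(ℝ, E) (fun y : G => g * y) x :=
  (contMDiff_mul_left (I := 𝓘(ℝ, E)) (n := ∞) (a := g)).mdifferentiableAt (by simp)

lemma mdifferentiableAt_mul_right (g x : G) :
    MDifferentiableAt 𝓘(ℝ, E) 𝓘(ℝ, E) (fun y : G => y * g) x :=
  (contMDiff_mul_right (I := 𝓘(ℝ, E)) (n := ∞) (a := g)).mdifferentiableAt (by simp)

variable (E) in
/-- The differential of left multiplication, read in the model space. -/
def leftTranslation (g : G) : E →L[ℝ] E := mfderivModel E E (fun x : G => g * x) 1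

lemma leftTranslation_mul (g h : G) : leftTranslation E (g * h) =
    (mfderivModel E E (fun x : G => g * x) h).comp (leftTranslation E h) := by
  have h1 := mfderivModel_comp (1 : G) (mdifferentiableAt_mul_left (E := E) g (h * 1))
    (mdifferentiableAt_mul_left h 1)
  simp only [← mul_assoc] at h1
  rw [mul_one] at h1
  exact h1

omit [LieGroup 𝓘(ℝ, E) ∞ G] in
lemma leftTranslation_one : leftTranslation E (1 : G) = ContinuousLinearMap.id ℝ E := by
  unfold leftTranslation
  simp only [one_mul]
  exact mfderivModel_id 1

lemma isInvertible_leftTranslation (g : G) : (leftTranslation E g).IsInvertible := by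
  refine ContinuousLinearMap.IsInvertible.of_inverse
    (g := mfderivModel E E (fun x : G => g⁻¹ * x) g) ?_ ?_
  · have h1 := mfderivModel_comp g (mdifferentiableAt_mul_left (E := E) g (g⁻¹ * g))
      (mdifferentiableAt_mul_left g⁻¹ g)
    simp only [mul_inv_cancel_left, inv_mul_cancel] at h1
    rw [mfderivModel_id] at h1
    exact h1.symm
  · rw [← leftTranslation_mul, inv_mul_cancel, leftTranslation_one]

/-- The adjoint action, read in the model space. -/
def adModel (g : G) : E →L[ℝ] E := mfderivModel E E (fun x : G => g * x * g⁻¹) 1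

/-- This is the derivative at `x = 1` of the identity `g h (h⁻¹ x h) = g x h`. -/
lemma mfderivModel_mul_right (g h : G) (X : E) :
    mfderivModel E E (fun x : G => x * h) g (leftTranslation E g X) =
      leftTranslation E (g * h) (adModel h⁻¹ X) := by
  have h1 := mfderivModel_comp (1 : G) (mdifferentiableAt_mul_right (E := E) h (g * 1))
    (mdifferentiableAt_mul_left g 1)
  have h2 := mfderivModel_comp (1 : G)
    (mdifferentiableAt_mul_left (E := E) (g * h) (h⁻¹ * 1 * h⁻¹⁻¹))
    ((contMDiff_conj (E := E) h⁻¹).mdifferentiableAt (by simp))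
  have h3 : (fun x : G => g * h * (h⁻¹ * x * h⁻¹⁻¹)) = fun x => g * x * h := by
    ext x
    group
  have h4 : h⁻¹ * 1 * h⁻¹⁻¹ = (1 : G) := by group
  rw [h3, h1, h4, mul_one] at h2
  exact congrArg (fun L : E →L[ℝ] E => L X) h2

/-- The left-invariant field is the tangent map of multiplication applied to the smooth map `g ↦
(0_g, X)` into `TG × TG`, with `X` at the identity. -/
lemma contMDiff_leftTranslation (X : E) :
    ContMDiff 𝓘(ℝ, E) (𝓘(ℝ, E).prod 𝓘(ℝ, E)) ∞
      (fun g : G => (⟨g, leftTranslation E g X⟩ : TangentBundle 𝓘(ℝ, E) G)) := by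
  have h0 : ContMDiff 𝓘(ℝ, E) (𝓘(ℝ, E).prod 𝓘(ℝ, E)) ∞
      (fun g : G => (⟨g, (0 : E)⟩ : TangentBundle 𝓘(ℝ, E) G)) :=
    Bundle.contMDiff_zeroSection ℝ (TangentSpace 𝓘(ℝ, E) : G → Type _)
  have hX : ContMDiff 𝓘(ℝ, E) (𝓘(ℝ, E).prod 𝓘(ℝ, E)) ∞
      (fun _ : G => (⟨1, X⟩ : TangentBundle 𝓘(ℝ, E) G)) := contMDiff_const
  have h1 := (contMDiff_equivTangentBundleProd_symm (n := ∞) (I := 𝓘(ℝ, E)) (M := G)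
    (I' := 𝓘(ℝ, E)) (M' := G)).comp (h0.prodMk hX)
  have h2 := ((contMDiff_mul 𝓘(ℝ, E) ∞ (G := G)).contMDiff_tangentMap (m := ∞) (by simp)).comp h1
  have hmul : ∀ g : G, MDifferentiableAt (𝓘(ℝ, E).prod 𝓘(ℝ, E)) 𝓘(ℝ, E)
      (fun p : G × G => p.1 * p.2) (g, 1) :=
    fun g => (contMDiff_mul 𝓘(ℝ, E) ∞).mdifferentiableAt (by simp)
  have h3 : (fun g : G => (⟨g, leftTranslation E g X⟩ : TangentBundle 𝓘(ℝ, E) G)) =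
      fun g : G => (⟨g * 1, (mfderiv (𝓘(ℝ, E).prod 𝓘(ℝ, E)) 𝓘(ℝ, E)
        (fun p : G × G => p.1 * p.2) (g, 1) : E × E →L[ℝ] E) (0, X)⟩ :
          TangentBundle 𝓘(ℝ, E) G) := by
    funext g
    have h4 : (mfderiv (𝓘(ℝ, E).prod 𝓘(ℝ, E)) 𝓘(ℝ, E)
        (fun p : G × G => p.1 * p.2) (g, 1) : E × E →L[ℝ] E) (0, X) = leftTranslation E g X := by
      refine (mfderiv_prod_eq_add_apply (hmul g)).trans ?_
      exact (congrArg (fun v : E => v + leftTranslation E g X)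
        (map_zero (mfderivModel E E (fun z : G => z * 1) g))).trans (zero_add _)
    have h5 : ∀ (x : G), x = g → (⟨g, leftTranslation E g X⟩ : TangentBundle 𝓘(ℝ, E) G) =
        ⟨x, leftTranslation E g X⟩ := by
      rintro _ rfl; rfl
    rw [h5 (g * 1) (mul_one g), h4]
  rw [h3]
  exact h2

lemma HasVelocityAt.mul_left {γ : ℝ → G} {X : E} {t : ℝ}
    (h : HasVelocityAt γ (leftTranslation E (γ t) X) t) (g : G) :
    HasVelocityAt (fun s => g * γ s) (leftTranslation E (g * γ t) X) t := by
  rw [leftTranslation_mul]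
  exact h.comp (mdifferentiableAt_mul_left g (γ t))

/-- The framing of `T G` by left-invariant vector fields. -/
def leftInvariantFraming : HorizontalFraming E E E (fun g : G => g) where
  lift := leftTranslation E
  contMDiff_proj := contMDiff_id
  surjective := Function.surjective_id
  contMDiff_lift := contMDiff_leftTranslation
  isInvertible_frame g := by
    rw [mfderivModel_id]
    exact isInvertible_leftTranslation g
  exists_section g := ⟨fun x => x, rfl, contMDiffAt_id, Filter.Eventually.of_forall fun _ => rfl⟩
  exists_symm := by
    rintro g _ rfl
    refine ⟨fun x => x, ContinuousLinearMap.id ℝ E, contMDiff_id, rfl, fun _ => rfl, fun x X => ?_⟩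
    rw [mfderivModel_id]
    rfl

lemma leftInvariantFraming_frame (g : G) :
    (leftInvariantFraming (E := E) (G := G)).frame g = leftTranslation E g := by
  unfold HorizontalFraming.frame
  rw [mfderivModel_id]
  rfl

variable [FiniteDimensional ℝ E] {H : Subgroup G}
  {F K : Type*} [NormedAddCommGroup F] [NormedSpace ℝ F] [NormedAddCommGroup K] [NormedSpace ℝ K]
  [ChartedSpace F (G ⧸ H)]

omit [FiniteDimensional ℝ E] in
-- A vertical vector is the velocity of a smooth curve in the fibre `gH`, and translation by `g⁻¹`
-- moves that curve into `H`. Conversely, a curve in `H` translated by `g` has constant projection.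
lemma mfderivModel_quotient_eq_zero_iff (hπ : Manifold.IsSubmersionOfComplement K 𝓘(ℝ, E) 𝓘(ℝ, F) ∞
    (fun g : G => (g : G ⧸ H))) (g : G) (X : E) :
    mfderivModel E F (fun g : G => (g : G ⧸ H)) g (leftTranslation E g X) = 0 ↔
      X ∈ tangentAtOne (E := E) H := by
  constructor
  · intro h
    obtain ⟨γ, hγ, hγ₀, hγv, hγπ⟩ := exists_vertical_curve (hπ g) h
    refine ⟨fun t => g⁻¹ * γ t, (contMDiff_mul_left (a := g⁻¹)).comp hγ,
      fun t => QuotientGroup.eq.1 (hγπ t).symm, by simp [hγ₀], ?_⟩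
    have h1 : HasVelocityAt γ (leftTranslation E (γ 0) X) 0 := by rwa [hγ₀]
    have h2 := h1.mul_left g⁻¹
    rw [hγ₀, inv_mul_cancel, leftTranslation_one] at h2
    refine HasMFDerivAt.congr_mfderiv h2 ?_
    exact ContinuousLinearMap.ext fun r => rfl
  · rintro ⟨γ, hγ, hγH, hγ₀, hγv⟩
    have h1 : HasVelocityAt γ (leftTranslation E (γ 0) X) 0 := by
      rw [hγ₀, leftTranslation_one]
      exact HasMFDerivAt.congr_mfderiv hγv (ContinuousLinearMap.ext fun r => rfl)
    have h2 := h1.mul_left g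
    have h3 := h2.comp ((hπ (g * γ 0)).contMDiffAt.mdifferentiableAt (by simp))
    have h4 : (fun s => ((g * γ s : G) : G ⧸ H)) = fun _ => ((g : G) : G ⧸ H) := by
      funext s
      exact (QuotientGroup.eq.2 (by simpa using hγH s)).symm
    rw [h4, hγ₀, mul_one] at h3
    have h5 : HasVelocityAt (fun _ : ℝ => ((g : G) : G ⧸ H)) (0 : F) 0 :=
      (hasMFDerivAt_const _ _).congr_mfderiv
        (ContinuousLinearMap.ext fun r : ℝ => (smul_zero (A := F) r).symm)
    exact h3.velocity_eq.symm.trans h5.velocity_eq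

omit [FiniteDimensional ℝ E] in
lemma InvariantComplement.exists_add_eq (M : InvariantComplement (E := E) H) (X : E) :
    ∃ Y Z : E, Y ∈ tangentAtOne (E := E) H ∧ Z ∈ M.normed ∧ Y + Z = X := by
  let X' : GroupLieAlgebra 𝓘(ℝ, E) G := X
  have h : X' ∈ tangentAtOne H ⊔ M.space := by
    rw [M.isCompl.sup_eq_top]
    exact Submodule.mem_top
  obtain ⟨Y, hY, Z, hZ, hX⟩ := Submodule.mem_sup.1 h
  exact ⟨Y, Z, hY, hZ, hX⟩

/-- The horizontal framing of `G → G/H` by an invariant complement. -/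
def quotientFraming (hπ : Manifold.IsSubmersionOfComplement K 𝓘(ℝ, E) 𝓘(ℝ, F) ∞
    (fun g : G => (g : G ⧸ H))) (M : InvariantComplement (E := E) H) :
    HorizontalFraming E F M.normed (fun g : G => (g : G ⧸ H)) where
  lift g := (leftTranslation E g).comp M.normed.subtypeL
  contMDiff_proj := hπ.contMDiff
  surjective := Quotient.mk_surjective
  contMDiff_lift a := contMDiff_leftTranslation (a : E)
  isInvertible_frame g := by
    -- The kernel of `π_*` corresponds to `T_e H`, which meets `M` only in zero; for surjectivity,
    -- the `T_e H`-component of a preimage can be discarded.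
    have hinj : Function.Injective ((mfderivModel E F (fun g : G => (g : G ⧸ H)) g).comp
        ((leftTranslation E g).comp M.normed.subtypeL)) := by
      refine (injective_iff_map_eq_zero _).2 fun a ha => ?_
      have h1 := (mfderivModel_quotient_eq_zero_iff hπ g a).1 ha
      exact Subtype.ext (Submodule.disjoint_def.1 M.isCompl.disjoint _ h1 a.2)
    have hsurj : Function.Surjective ((mfderivModel E F (fun g : G => (g : G ⧸ H)) g).comp
        ((leftTranslation E g).comp M.normed.subtypeL)) := by
      intro v
      obtain ⟨w, rfl⟩ := surjective_mfderivModel_of_isSubmersionAt (hπ g) v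
      obtain ⟨X, rfl⟩ := (isInvertible_leftTranslation (E := E) g).surjective w
      obtain ⟨Y, Z, hY, hZ, hX⟩ := M.exists_add_eq X
      refine ⟨⟨Z, hZ⟩, ?_⟩
      have h1 := (mfderivModel_quotient_eq_zero_iff hπ g Y).2 hY
      rw [← hX, map_add, map_add, h1, zero_add]
      rfl
    exact ⟨(LinearEquiv.ofBijective _ ⟨hinj, hsurj⟩).toContinuousLinearEquiv,
      ContinuousLinearMap.ext fun _ => rfl⟩
  exists_section g := exists_section_of_isSubmersionAt (hπ g)
  exists_symm := by
    intro g g' h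
    have hmem := QuotientGroup.eq.1 h
    -- The symmetry is right multiplication by `h = g⁻¹ g'`. It changes left-invariant directions by
    -- `Ad h⁻¹`, which is a map of `M` into itself by invariance.
    refine ⟨fun x => x * (g⁻¹ * g'), (M.ad (⟨_, hmem⟩ : H)⁻¹).toContinuousLinearMap,
      contMDiff_mul_right (a := g⁻¹ * g'), by simp, fun x => ?_, fun x a => ?_⟩
    · exact (QuotientGroup.eq.2 (by simpa using hmem)).symm
    · exact mfderivModel_mul_right x (g⁻¹ * g') (a : E)

end LieGroup

/-! ### From local to global lifts of geodesics. -/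

section Completeness

variable {E F A : Type*} [NormedAddCommGroup E] [NormedSpace ℝ E] [CompleteSpace E]
    [NormedAddCommGroup F] [NormedSpace ℝ F] [NormedAddCommGroup A] [NormedSpace ℝ A]
    {P : Type*} [TopologicalSpace P] [ChartedSpace E P] [IsManifold 𝓘(ℝ, E) ∞ P]
    {N : Type*} [TopologicalSpace N] [ChartedSpace F N] [IsManifold 𝓘(ℝ, F) ∞ N] {pr : P → N}

namespace HorizontalFraming

variable {fr : HorizontalFraming E F A pr}

omit [CompleteSpace E] [IsManifold 𝓘(ℝ, F) ∞ N] in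
lemma eventually_eq_of_hasVelocityAt {γ δ : ℝ → P} {a : A} {t₀ : ℝ}
    (hγ : ∀ᶠ t in 𝓝 t₀, HasVelocityAt γ (fr.lift (γ t) a) t)
    (hδ : ∀ᶠ t in 𝓝 t₀, HasVelocityAt δ (fr.lift (δ t) a) t) (h : γ t₀ = δ t₀) :
    γ =ᶠ[𝓝 t₀] δ :=
  isMIntegralCurveAt_eventuallyEq_of_contMDiffAt_boundaryless (I := 𝓘(ℝ, E))
    (v := fun p => fr.lift p a) ((fr.contMDiff_lift a _).of_le (by simp)) hγ hδ h

omit [CompleteSpace E] [IsManifold 𝓘(ℝ, F) ∞ N] in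
lemma eqOn_ball_of_hasVelocityAt [T2Space P] {γ δ : ℝ → P} {a : A} {t₀ t₁ ε : ℝ}
    (hγ : ∀ t ∈ Metric.ball t₀ ε, HasVelocityAt γ (fr.lift (γ t) a) t)
    (hδ : ∀ t ∈ Metric.ball t₀ ε, HasVelocityAt δ (fr.lift (δ t) a) t)
    (ht₁ : t₁ ∈ Metric.ball t₀ ε) (h : γ t₁ = δ t₁) :
    ∀ t ∈ Metric.ball t₀ ε, γ t = δ t := by
  rw [Real.ball_eq_Ioo] at *
  exact isMIntegralCurveOn_Ioo_eqOn_of_contMDiff_boundaryless (I := 𝓘(ℝ, E))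
    (v := fun p => fr.lift p a) ht₁ ((fr.contMDiff_lift a).of_le (by simp))
    (fun t ht => (hγ t ht).hasMFDerivWithinAt) (fun t ht => (hδ t ht).hasMFDerivWithinAt) h

variable [FiniteDimensional ℝ A] [T2Space P]
  {cov : CovariantDerivative 𝓘(ℝ, F) F (TangentSpace 𝓘(ℝ, F) : N → Type _)}

/-- A geodesic which coincides near one time with the projection of a global horizontal curve of
constant direction coincides with it everywhere. -/
lemma IsInduced.eqOn_of_eventuallyEq (h : fr.IsInduced cov) {c : ℝ → N} {J : Set ℝ}
    (hJ : IsOpen J) (hJ' : J.OrdConnected) (hc : IsGeodesicOn cov c J) {Γ : ℝ → P} {a : A}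
    (hΓ : ∀ t, HasVelocityAt Γ (fr.lift (Γ t) a) t) {t₀ : ℝ} (ht₀ : t₀ ∈ J)
    (h₀ : ∀ᶠ t in 𝓝 t₀, c t = pr (Γ t)) : ∀ t ∈ J, c t = pr (Γ t) := by
  -- The times near which `c` agrees with `pr ∘ Γ` form an open set; as `J` is connected, it is
  -- enough that this set be closed relative to `J`.
  have hsub : J ⊆ {t | ∀ᶠ s in 𝓝 t, c s = pr (Γ s)} := by
    refine hJ'.isPreconnected.subset_of_closure_inter_subset isOpen_setOfPred_eventually_nhds
      ⟨t₀, ht₀, h₀⟩ ?_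
    rintro t₁ ⟨ht₁, ht₁J⟩
    obtain ⟨p₁, hp₁⟩ := fr.surjective (c t₁)
    obtain ⟨δ, b, -, hcδ, hδ⟩ := h.exists_lift_of_geodesic hJ hc ht₁J hp₁
    obtain ⟨ε, hε, hball⟩ := Metric.eventually_nhds_iff_ball.1 (hcδ.and hδ)
    obtain ⟨t₂, ht₂, ht₂S⟩ := mem_closure_iff.1 ht₁ _ Metric.isOpen_ball
      (Metric.mem_ball_self hε)
    have hnhds := Metric.isOpen_ball.mem_nhds ht₂
    have ht₂' : pr (δ t₂) = pr (Γ t₂) := (hball t₂ ht₂).1.symm.trans ht₂S.self_of_nhds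
    -- A lift `δ` around the limit time need only meet the fibre of `Γ t₂`. The symmetry moves it to
    -- `Γ t₂` itself while keeping its direction constant.
    obtain ⟨R, ρ, hR, hRδ, hprR, hRρ⟩ := fr.exists_symm _ _ ht₂'
    have hRv : ∀ t ∈ Metric.ball t₁ ε, HasVelocityAt (fun s => R (δ s))
        (fr.lift (R (δ t)) (ρ b)) t := by
      intro t ht
      rw [← hRρ]
      exact (hball t ht).2.comp (hR.mdifferentiableAt (by simp))
    -- Both directions represent the velocity of `c` at `t₂` in the same frame. With point and
    -- direction equal, uniqueness of integral curves gives agreement on the whole ball.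
    have hab : a = ρ b := by
      have h1 := (velocity_eq_frame ht₂S (hΓ t₂)).velocity_eq
      have h2 : c =ᶠ[𝓝 t₂] fun s => pr (R (δ s)) := by
        filter_upwards [hnhds] with t ht
        rw [hprR]
        exact (hball t ht).1
      have h3 := (velocity_eq_frame h2 (hRv t₂ ht₂)).velocity_eq
      rw [hRδ] at h3
      exact (fr.isInvertible (Γ t₂)).injective (h1.symm.trans h3)
    subst hab
    have heq := eqOn_ball_of_hasVelocityAt (fun t _ => hΓ t) hRv ht₂ hRδ.symm
    filter_upwards [Metric.ball_mem_nhds t₁ hε] with t ht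
    rw [heq t ht, hprR]
    exact (hball t ht).1
  exact fun t ht => (hsub ht).self_of_nhds

/-- If the horizontal curves of constant direction are complete, then every geodesic is the
projection of one of them. -/
lemma IsInduced.exists_global_lift (h : fr.IsInduced cov)
    (hcomplete : ∀ p a, ∃ Γ : ℝ → P, Γ 0 = p ∧ ∀ t, HasVelocityAt Γ (fr.lift (Γ t) a) t)
    {c : ℝ → N} {J : Set ℝ} (hJ : IsOpen J) (hJ' : J.OrdConnected) (hc : IsGeodesicOn cov c J)
    {t₀ : ℝ} (ht₀ : t₀ ∈ J) :
    ∃ (Γ : ℝ → P) (a : A), (∀ t, HasVelocityAt Γ (fr.lift (Γ t) a) t) ∧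
      ∀ t ∈ J, c t = pr (Γ t) := by
  obtain ⟨p₀, hp₀⟩ := fr.surjective (c t₀)
  obtain ⟨γ, a, hγ₀, hcγ, hγ⟩ := h.exists_lift_of_geodesic hJ hc ht₀ hp₀
  obtain ⟨Γ, hΓ₀, hΓ⟩ := hcomplete p₀ a
  have hΓ' : ∀ t, HasVelocityAt (fun s => Γ (s - t₀)) (fr.lift (Γ (t - t₀)) a) t := by
    have h1 : IsMIntegralCurve (I := 𝓘(ℝ, E)) Γ (fun p => fr.lift p a) := hΓ
    exact isMIntegralCurve_comp_sub.2 h1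
  refine ⟨fun s => Γ (s - t₀), a, hΓ', h.eqOn_of_eventuallyEq hJ hJ' hc hΓ' ht₀ ?_⟩
  have heq := eventually_eq_of_hasVelocityAt hγ (Filter.Eventually.of_forall hΓ')
    (by rw [hγ₀, sub_self, hΓ₀])
  filter_upwards [hcγ, heq] with t h1 h2
  rw [h1, h2]

end HorizontalFraming

end Completeness

/-! ### Completeness of left-invariant vector fields. -/

section LieGroup

variable {E : Type*} [NormedAddCommGroup E] [NormedSpace ℝ E] [CompleteSpace E]
  {G : Type*} [TopologicalSpace G] [ChartedSpace E G] [Group G]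

variable (E G) in
omit [CompleteSpace E] in
-- The manifold structure gives `T1`, and a `T1` topological group is Hausdorff. Uniqueness of
-- integral curves on intervals uses this.
lemma t2Space_of_lieGroup [LieGroup 𝓘(ℝ, E) ∞ G] : T2Space G := by
  have := topologicalGroup_of_lieGroup 𝓘(ℝ, E) ∞ (G := G)
  have : T1Space G := 𝓘(ℝ, E).t1Space G
  infer_instance

/-- Left-invariant vector fields are complete. -/
lemma exists_integralCurve_leftTranslation [LieGroup 𝓘(ℝ, E) ∞ G] (g : G) (X : E) :
    ∃ Γ : ℝ → G, Γ 0 = g ∧ ∀ t, HasVelocityAt Γ (leftTranslation E (Γ t) X) t := by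
  have := t2Space_of_lieGroup E G
  have hV : ContMDiff 𝓘(ℝ, E) (𝓘(ℝ, E).prod 𝓘(ℝ, E)) 1
      (fun g : G => (⟨g, leftTranslation E g X⟩ : TangentBundle 𝓘(ℝ, E) G)) :=
    (contMDiff_leftTranslation X).of_le (by simp)
  obtain ⟨γ, hγ₀, hγ⟩ := exists_isMIntegralCurveAt_of_contMDiffAt_boundaryless 0 (hV 1)
  obtain ⟨ε, hε, hball⟩ := Metric.eventually_nhds_iff_ball.1 hγ
  -- Left translates of the integral curve through `1` all exist on the same interval `(-ε, ε)`; a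
  -- uniform existence time implies completeness.
  refine exists_isMIntegralCurve_of_isMIntegralCurveOn (I := 𝓘(ℝ, E))
    (v := fun g : G => leftTranslation E g X) hV hε (fun g => ?_) g
  refine ⟨fun t => g * γ t, by simp [hγ₀], fun t ht => ?_⟩
  have h1 : HasVelocityAt γ (leftTranslation E (γ t) X) t :=
    hball t (by rw [Real.ball_eq_Ioo]; simpa using ht)
  exact HasMFDerivAt.hasMFDerivWithinAt (h1.mul_left g)

end LieGroup

/-! ### The connections of the theorem as induced connections of framings. -/

section Quotient

variable {E : Type*} [NormedAddCommGroup E] [NormedSpace ℝ E] [FiniteDimensional ℝ E]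
  {G : Type*} [TopologicalSpace G] [ChartedSpace E G] [Group G] [LieGroup 𝓘(ℝ, E) ∞ G]
  {H : Subgroup G} {M : InvariantComplement (E := E) H}
  {F K : Type*} [NormedAddCommGroup F] [NormedSpace ℝ F] [NormedAddCommGroup K] [NormedSpace ℝ K]
  [ChartedSpace F (G ⧸ H)]
  {hπ : Manifold.IsSubmersionOfComplement K 𝓘(ℝ, E) 𝓘(ℝ, F) ∞ (fun g : G => (g : G ⧸ H))}

omit [FiniteDimensional ℝ E] in
-- Left translations are invertible, so the function `f` in the definition can only be `rep σ`, and
-- every tangent vector is a left-translated one.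
lemma isCanonicalLeftInvariant_iff
    {cov : CovariantDerivative 𝓘(ℝ, E) E (TangentSpace 𝓘(ℝ, E) : G → Type _)} :
    IsCanonicalLeftInvariant cov ↔ leftInvariantFraming.IsInduced cov := by
  have hfr : ∀ (g : G) (X : E), (leftInvariantFraming (E := E) (G := G)).frame g X =
      leftTranslation E g X := fun g X => by rw [leftInvariantFraming_frame]
  constructor
  · intro h σ g hσ X
    have h1 := h σ (leftInvariantFraming.rep σ)
      (fun g => ((hfr g _).symm.trans (leftInvariantFraming.frame_rep σ g)).symm) g hσ
      (leftTranslation E g X)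
    rw [hfr, hfr]
    exact h1
  · intro h σ f hf g hσ w
    have hrep : leftInvariantFraming.rep σ = f := funext fun g =>
      leftInvariantFraming.rep_eq_of_frame_eq ((hfr g (f g)).trans (hf g).symm)
    obtain ⟨X, rfl⟩ := (isInvertible_leftTranslation (E := E) g).surjective w
    have h1 := h σ g hσ X
    rw [hfr, hfr] at h1
    unfold HorizontalFraming.repDeriv at h1
    rw [hrep] at h1
    exact h1

omit [FiniteDimensional ℝ E] in
lemma leftTranslation_mem_horizontal_iff (g : G) (X : E) :
    leftTranslation E g X ∈ horizontal M g ↔ X ∈ M.normed := by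
  constructor
  · rintro ⟨Y, hY, hYX⟩
    have h1 : Y = X := (isInvertible_leftTranslation (E := E) g).injective hYX
    exact h1 ▸ hY
  · exact fun hX => ⟨X, hX, rfl⟩

omit [FiniteDimensional ℝ E] in
-- Complementarity is the decomposition `T_e H ⊕ M` translated by `g`; right invariance is
-- `Ad_H`-invariance of `M`; left-invariant fields with value in `M` at the identity are the smooth
-- horizontal extensions.
lemma isPrincipalConnection_horizontal
    (hπ : Manifold.IsSubmersionOfComplement K 𝓘(ℝ, E) 𝓘(ℝ, F) ∞ (fun g : G => (g : G ⧸ H)))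
    (M : InvariantComplement (E := E) H) : IsPrincipalConnection F H (horizontal M) where
  isCompl g := by
    constructor
    · refine Submodule.disjoint_def.2 ?_
      rintro _ hw ⟨X, hX, rfl⟩
      have h1 := (mfderivModel_quotient_eq_zero_iff hπ g X).1 hw
      have h2 : X = 0 := Submodule.disjoint_def.1 M.isCompl.disjoint _ h1 hX
      rw [h2]
      exact map_zero _
    · rw [codisjoint_iff, Submodule.eq_top_iff']
      intro w
      obtain ⟨X, hX⟩ := (isInvertible_leftTranslation (E := E) g).surjective w
      obtain ⟨Y, Z, hY, hZ, hYZ⟩ := M.exists_add_eq X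
      refine Submodule.mem_sup.2 ⟨leftTranslation E g Y,
        (mfderivModel_quotient_eq_zero_iff hπ g Y).2 hY, leftTranslation E g Z,
        (leftTranslation_mem_horizontal_iff g Z).2 hZ, ?_⟩
      refine Eq.trans ?_ hX
      rw [← hYZ]
      exact (map_add (leftTranslation E g) Y Z).symm
  right_invariant h hh g := by
    refine le_antisymm ?_ ?_
    · rintro _ ⟨_, ⟨X, hX, rfl⟩, rfl⟩
      exact ⟨Ad h⁻¹ X, M.ad_mem _ (H.inv_mem hh) X hX, (mfderivModel_mul_right (E := E) g h X).symm⟩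
    · rintro _ ⟨X, hX, rfl⟩
      refine ⟨leftTranslation E g (Ad h X), ⟨Ad h X, M.ad_mem _ hh X hX, rfl⟩, ?_⟩
      refine (mfderivModel_mul_right (E := E) g h _).trans ?_
      have h1 : M.ad (⟨h, hh⟩ : H)⁻¹ (M.ad ⟨h, hh⟩ ⟨X, hX⟩) = ⟨X, hX⟩ := by
        rw [← M.ad_mul, inv_mul_cancel, M.ad_one]
      exact congrArg (fun Y : M.normed => leftTranslation E (g * h) (Y : E)) h1
  smooth g := by
    rintro _ ⟨X, hX, rfl⟩
    exact ⟨fun x => leftTranslation E x X, rfl, Filter.Eventually.of_forall fun x => ⟨X, hX, rfl⟩,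
      contMDiff_leftTranslation (E := E) X g⟩

variable [IsManifold 𝓘(ℝ, F) ∞ (G ⧸ H)]

/-- Again `f` must be `rep σ`, since `toTangent` is the frame of `quotientFraming`, and each
horizontal vector is the lift of an element of `M`. -/
lemma isInducedConnection_iff
    {cov : CovariantDerivative 𝓘(ℝ, F) F (TangentSpace 𝓘(ℝ, F) : G ⧸ H → Type _)} :
    IsInducedConnection M (horizontal M) cov ↔ (quotientFraming hπ M).IsInduced cov := by
  constructor
  · intro h σ g hσ a
    exact h σ ((quotientFraming hπ M).rep σ)
      (fun g => ((quotientFraming hπ M).frame_rep σ g).symm) g hσ (leftTranslation E g (a : E))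
      ⟨(a : E), a.2, rfl⟩
  · intro h σ f hf g hσ w hw
    have hrep : (quotientFraming hπ M).rep σ = f := funext fun g =>
      (quotientFraming hπ M).rep_eq_of_frame_eq (hf g).symm
    obtain ⟨X, hX, rfl⟩ := hw
    have h1 := h σ g hσ ⟨X, hX⟩
    unfold HorizontalFraming.repDeriv at h1
    rw [hrep] at h1
    exact h1

/-- Geodesics of the induced connection are the projections of the horizontal integral curves of
left-invariant vector fields. -/
lemma isGeodesicOn_iff_exists_integralCurve
    (hπ : Manifold.IsSubmersionOfComplement K 𝓘(ℝ, E) 𝓘(ℝ, F) ∞ (fun g : G => (g : G ⧸ H)))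
    {cov : CovariantDerivative 𝓘(ℝ, F) F (TangentSpace 𝓘(ℝ, F) : G ⧸ H → Type _)}
    (hcov : IsInducedConnection M (horizontal M) cov) {J : Set ℝ} (hJ : IsOpen J)
    (hJ' : J.OrdConnected) {c : ℝ → G ⧸ H} :
    IsGeodesicOn cov c J ↔ ∃ (X : M.normed) (γ : ℝ → G),
      (∀ t ∈ J, HasVelocityAt γ (leftTranslation E (γ t) (X : E)) t) ∧
      ∀ t ∈ J, (γ t : G ⧸ H) = c t := by
  have := t2Space_of_lieGroup E G
  have hfr : (quotientFraming hπ M).IsInduced cov := isInducedConnection_iff.1 hcov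
  constructor
  · intro hc
    rcases J.eq_empty_or_nonempty with rfl | ⟨t₀, ht₀⟩
    · exact ⟨0, fun _ => 1, by simp, by simp⟩
    have : CompleteSpace E := FiniteDimensional.complete ℝ E
    obtain ⟨Γ, X, hΓ, hcΓ⟩ := hfr.exists_global_lift
      (fun g X => exists_integralCurve_leftTranslation g (X : E)) hJ hJ' hc ht₀
    exact ⟨X, Γ, fun t _ => hΓ t, fun t ht => (hcΓ t ht).symm⟩
  · rintro ⟨X, γ, hγ, hcγ⟩
    exact hfr.isGeodesicOn hJ (a := X) hγ fun t ht => (hcγ t ht).symm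

/-- Geodesics of the induced connection are the projections of the geodesics of the canonical
left-invariant connection which are horizontal at one time. -/
lemma isGeodesicOn_iff_exists_isGeodesicOn
    (hπ : Manifold.IsSubmersionOfComplement K 𝓘(ℝ, E) 𝓘(ℝ, F) ∞ (fun g : G => (g : G ⧸ H)))
    {cov : CovariantDerivative 𝓘(ℝ, F) F (TangentSpace 𝓘(ℝ, F) : G ⧸ H → Type _)}
    (hcov : IsInducedConnection M (horizontal M) cov)
    {covG : CovariantDerivative 𝓘(ℝ, E) E (TangentSpace 𝓘(ℝ, E) : G → Type _)}
    (hcovG : IsCanonicalLeftInvariant covG) {J : Set ℝ} (hJ : IsOpen J)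
    (hJ' : J.OrdConnected) {c : ℝ → G ⧸ H} {t₀ : ℝ} (ht₀ : t₀ ∈ J) :
    IsGeodesicOn cov c J ↔ ∃ γ : ℝ → G, IsGeodesicOn covG γ J ∧
      velocity γ t₀ ∈ horizontal M (γ t₀) ∧ ∀ t ∈ J, (γ t : G ⧸ H) = c t := by
  have := t2Space_of_lieGroup E G
  have : CompleteSpace E := FiniteDimensional.complete ℝ E
  have hfr := isCanonicalLeftInvariant_iff.1 hcovG
  rw [isGeodesicOn_iff_exists_integralCurve hπ hcov hJ hJ']
  constructor
  · rintro ⟨X, γ, hγ, hcγ⟩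
    refine ⟨γ, hfr.isGeodesicOn hJ (a := (X : E)) hγ fun _ _ => rfl, ?_, hcγ⟩
    have h1 := (leftTranslation_mem_horizontal_iff (M := M) (γ t₀) (X : E)).2 X.2
    rw [← (hγ t₀ ht₀).velocity_eq] at h1
    exact h1
  · rintro ⟨γ, hγ, hhor, hcγ⟩
    -- For the framing of `TG` this says that a geodesic of `∇^G` is on `J` an integral curve of one
    -- left-invariant field `X`. Horizontality at `t₀` then gives `X ∈ M`, hence horizontality at
    -- all times of `J`.
    obtain ⟨Γ, X, hΓ, hγΓ⟩ := hfr.exists_global_lift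
      (fun g X => exists_integralCurve_leftTranslation g X) hJ hJ' hγ ht₀
    have hv : HasVelocityAt γ (leftTranslation E (γ t₀) X) t₀ := by
      have h1 : γ =ᶠ[𝓝 t₀] Γ := Filter.mem_of_superset (hJ.mem_nhds ht₀) hγΓ
      rw [hγΓ t₀ ht₀]
      exact (hΓ t₀).congr h1
    have hX : leftTranslation E (γ t₀) X ∈ horizontal M (γ t₀) := by
      have h1 := hv.velocity_eq
      exact h1 ▸ hhor
    refine ⟨⟨X, (leftTranslation_mem_horizontal_iff (γ t₀) X).1 hX⟩, Γ, fun t _ => hΓ t,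
      fun t ht => ?_⟩
    rw [← hγΓ t ht]
    exact hcγ t ht

end Quotient

/-! ### Smooth structures transported along a homeomorphism. -/

section Transport

variable {B H B' X Y : Type*} [NormedAddCommGroup B] [NormedSpace ℝ B] [TopologicalSpace H]
  (I : ModelWithCorners ℝ B H) [I.Boundaryless] [NormedAddCommGroup B'] [NormedSpace ℝ B']
  [TopologicalSpace X] [TopologicalSpace Y] (κ : B ≃L[ℝ] B') (Φ : X ≃ₜ Y)

/-- A chart transported along a homeomorphism and a linear isomorphism of model spaces. -/
def transportChart (e : OpenPartialHomeomorph Y H) : OpenPartialHomeomorph X B' :=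
  Φ.toOpenPartialHomeomorph ≫ₕ e ≫ₕ
    (I.toHomeomorph.trans κ.toHomeomorph).toOpenPartialHomeomorph

lemma transportChart_apply (e : OpenPartialHomeomorph Y H) (x : X) :
    transportChart I κ Φ e x = κ (I (e (Φ x))) := rfl

lemma transportChart_symm_apply (e : OpenPartialHomeomorph Y H) (v : B') :
    (transportChart I κ Φ e).symm v = Φ.symm (e.symm (I.symm (κ.symm v))) := rfl

lemma transportChart_source (e : OpenPartialHomeomorph Y H) :
    (transportChart I κ Φ e).source = Φ ⁻¹' e.source := by
  simp [transportChart]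

lemma transportChart_target (e : OpenPartialHomeomorph Y H) :
    (transportChart I κ Φ e).target = {v | I.symm (κ.symm v) ∈ e.target} := by
  ext v
  simp [transportChart]

variable [ChartedSpace H Y]

/-- The charted space structure transported along a homeomorphism, with the model replaced by a
linearly isomorphic normed space. -/
abbrev transportChartedSpace : ChartedSpace B' X where
  atlas := transportChart I κ Φ '' atlas H Y
  chartAt x := transportChart I κ Φ (chartAt H (Φ x))
  mem_chart_source x := by simp [transportChart_source]
  chart_mem_atlas x := ⟨_, chart_mem_atlas H (Φ x), rfl⟩

/-- The coordinate changes are those of `Y` conjugated by the linear isomorphism `κ`. -/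
lemma isManifold_transport [IsManifold I ∞ Y] :
    letI := transportChartedSpace I κ Φ
    IsManifold 𝓘(ℝ, B') ∞ X := by
  let := transportChartedSpace I κ Φ
  refine isManifold_of_contDiffOn 𝓘(ℝ, B') ∞ X ?_
  rintro _ _ ⟨e₁, h₁, rfl⟩ ⟨e₂, h₂, rfl⟩
  have h := ((contDiffGroupoid ∞ I).compatible h₁ h₂).1
  refine (κ.contDiff.comp_contDiffOn (h.comp κ.symm.contDiff.contDiffOn
    (s := κ.symm ⁻¹' (I.symm ⁻¹' (e₁.symm ≫ₕ e₂).source ∩ Set.range I))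
    (fun _ hx => hx))).congr_mono ?_ ?_
  · intro v hv
    simp [transportChart_apply, transportChart_symm_apply]
  · intro v hv
    simpa [transportChart_source, transportChart_target, transportChart_symm_apply,
      I.range_eq_univ] using hv

lemma contMDiff_transport [IsManifold I ∞ Y] :
    letI := transportChartedSpace I κ Φ
    ContMDiff 𝓘(ℝ, B') I ∞ Φ := by
  let := transportChartedSpace I κ Φ
  have := isManifold_transport I κ Φ
  intro x
  have he : chartAt H (Φ x) ∈ IsManifold.maximalAtlas I ∞ Y := IsManifold.chart_mem_maximalAtlas _
  have hc : ContMDiffAt 𝓘(ℝ, B') 𝓘(ℝ, B') ∞ (chartAt B' x) x :=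
    (contMDiffOn_of_mem_maximalAtlas (IsManifold.chart_mem_maximalAtlas x)).contMDiffAt
      ((chartAt B' x).open_source.mem_nhds (mem_chart_source B' x))
  have h1 : ContMDiffAt 𝓘(ℝ, B') 𝓘(ℝ, B) ∞ (fun y => κ.symm (chartAt B' x y)) x :=
    (κ.symm.contDiff (n := ∞)).contMDiff.contMDiffAt.comp x hc
  have hx : κ.symm (chartAt B' x x) ∈ ((chartAt H (Φ x)).extend I).target := by
    change κ.symm (κ (I (chartAt H (Φ x) (Φ x)))) ∈ _
    rw [κ.symm_apply_apply]
    exact ((chartAt H (Φ x)).extend I).map_source (by simp)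
  have h2 : ContMDiffAt 𝓘(ℝ, B) I ∞ ((chartAt H (Φ x)).extend I).symm
      (κ.symm (chartAt B' x x)) := by
    refine (contMDiffOn_extend_symm he).contMDiffAt ?_
    have h3 := ((chartAt H (Φ x)).isOpen_extend_target (I := I)).mem_nhds hx
    rwa [OpenPartialHomeomorph.extend_target'] at h3
  refine (ContMDiffAt.comp x h2 h1).congr_of_eventuallyEq ?_
  filter_upwards [(chartAt B' x).open_source.mem_nhds (mem_chart_source B' x)] with y hy
  change Φ y = ((chartAt H (Φ x)).extend I).symm (κ.symm (κ (I (chartAt H (Φ x) (Φ y)))))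
  rw [κ.symm_apply_apply]
  refine (((chartAt H (Φ x)).extend I).left_inv ?_).symm
  rw [OpenPartialHomeomorph.extend_source]
  exact (transportChart_source I κ Φ (chartAt H (Φ x))).subset hy

lemma contMDiff_transport_symm [IsManifold I ∞ Y] :
    letI := transportChartedSpace I κ Φ
    ContMDiff I 𝓘(ℝ, B') ∞ Φ.symm := by
  let := transportChartedSpace I κ Φ
  have := isManifold_transport I κ Φ
  intro y
  obtain ⟨x, rfl⟩ := Φ.surjective y
  have he : chartAt H (Φ x) ∈ IsManifold.maximalAtlas I ∞ Y := IsManifold.chart_mem_maximalAtlas _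
  have hs := (chartAt H (Φ x)).open_source.mem_nhds (mem_chart_source H (Φ x))
  have h1 : ContMDiffAt I 𝓘(ℝ, B') ∞ (fun z => κ ((chartAt H (Φ x)).extend I z)) (Φ x) :=
    (κ.contDiff (n := ∞)).contMDiff.contMDiffAt.comp (Φ x)
      (I.contMDiff.contMDiffAt.comp (Φ x) ((contMDiffOn_of_mem_maximalAtlas he).contMDiffAt hs))
  have h2 : ContMDiffAt 𝓘(ℝ, B') 𝓘(ℝ, B') ∞ (chartAt B' x).symm
      (κ ((chartAt H (Φ x)).extend I (Φ x))) :=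
    (contMDiffOn_symm_of_mem_maximalAtlas (IsManifold.chart_mem_maximalAtlas x)).contMDiffAt
      ((chartAt B' x).open_target.mem_nhds ((chartAt B' x).map_source (mem_chart_source B' x)))
  refine (ContMDiffAt.comp (Φ x) h2 h1).congr_of_eventuallyEq ?_
  filter_upwards [hs] with z hz
  change Φ.symm z = Φ.symm ((chartAt H (Φ x)).symm (I.symm (κ.symm (κ (I (chartAt H (Φ x) z))))))
  rw [κ.symm_apply_apply, I.left_inv, OpenPartialHomeomorph.left_inv _ hz]

/-- The transported atlas uses only the atlas of `Y`; the submersion normal form needs charts from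
its maximal atlas, which is why this extension is required. -/
lemma transportChart_mem_maximalAtlas [IsManifold I ∞ Y] {e : OpenPartialHomeomorph Y H}
    (he : e ∈ IsManifold.maximalAtlas I ∞ Y) :
    letI := transportChartedSpace I κ Φ
    transportChart I κ Φ e ∈ IsManifold.maximalAtlas 𝓘(ℝ, B') ∞ X := by
  let := transportChartedSpace I κ Φ
  have := isManifold_transport I κ Φ
  refine OpenPartialHomeomorph.mem_maximalAtlas_of_contMDiffOn _ ?_ ?_
  · have h1 := (I.contMDiff.comp_contMDiffOn (contMDiffOn_of_mem_maximalAtlas he)).comp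
      (contMDiff_transport I κ Φ).contMDiffOn
      (s := Φ ⁻¹' e.source) fun _ hx => hx
    rw [transportChart_source]
    exact (κ.contDiff (n := ∞)).contMDiff.comp_contMDiffOn h1
  · have h1 := (contMDiffOn_extend_symm he).comp (κ.symm.contDiff (n := ∞)).contMDiff.contMDiffOn
      (s := (transportChart I κ Φ e).target) fun v hv => by
        rw [transportChart_target] at hv
        exact ⟨_, hv, I.right_inv (by simp [I.range_eq_univ])⟩
    exact (contMDiff_transport_symm I κ Φ).comp_contMDiffOn h1

end Transport

/-! ### The map `P × A → T N` and its openness. -/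

section Total

variable {E F A : Type*} [NormedAddCommGroup E] [NormedSpace ℝ E]
    [NormedAddCommGroup F] [NormedSpace ℝ F] [NormedAddCommGroup A] [NormedSpace ℝ A]
    [FiniteDimensional ℝ A]
    {P : Type*} [TopologicalSpace P] [ChartedSpace E P] [IsManifold 𝓘(ℝ, E) ∞ P]
    {N : Type*} [TopologicalSpace N] [ChartedSpace F N] [IsManifold 𝓘(ℝ, F) ∞ N] {pr : P → N}

namespace HorizontalFraming

variable (fr : HorizontalFraming E F A pr)

omit [FiniteDimensional ℝ A] [IsManifold 𝓘(ℝ, F) ∞ N] in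
/-- The map `P × A → T N` given by a framing. -/
def total (q : P × A) : TangentBundle 𝓘(ℝ, F) N := ⟨pr q.1, fr.frame q.1 q.2⟩

lemma contMDiff_total : ContMDiff (𝓘(ℝ, E).prod 𝓘(ℝ, A)) 𝓘(ℝ, F).tangent ∞ fr.total := fun _ =>
  contMDiffAt_tangent_apply (fun a => fr.contMDiff_frame a _) contMDiffAt_fst contMDiffAt_snd

omit [FiniteDimensional ℝ A] [IsManifold 𝓘(ℝ, F) ∞ N] in
lemma surjective_total : Function.Surjective fr.total := by
  rintro ⟨x, v⟩
  obtain ⟨p, rfl⟩ := fr.surjective x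
  obtain ⟨a, rfl⟩ := (fr.isInvertible p).surjective v
  exact ⟨(p, a), rfl⟩

/-- Through each `(p, a)` passes a local continuous right inverse: a section `s` of `pr` on the
base, and the inverse coordinate frame along `s` on the fibre. A map with such right inverses is
open. -/
lemma isOpenMap_total : IsOpenMap fr.total := by
  refine IsOpenMap.of_nhds_le ?_
  rintro ⟨p, a⟩
  obtain ⟨s, hsp, hs, hs'⟩ := fr.exists_section p
  have hmem := mem_trivSet (F := F) (pr p)
  let e := trivializationAt F (TangentSpace 𝓘(ℝ, F) : N → Type _) (pr p)
  let τ : TangentBundle 𝓘(ℝ, F) N → P × A :=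
    fun z => (s z.proj, (fr.frameCoord (pr p) (s z.proj)).inverse (e z).2)
  have hproj : ContinuousAt (fun z : TangentBundle 𝓘(ℝ, F) N => z.proj) (fr.total (p, a)) :=
    (FiberBundle.continuous_proj F (TangentSpace 𝓘(ℝ, F) : N → Type _)).continuousAt
  have hs1 : ContinuousAt (fun z : TangentBundle 𝓘(ℝ, F) N => s z.proj) (fr.total (p, a)) :=
    ContinuousAt.comp (g := s) hs.continuousAt hproj
  have hinv : ContinuousAt (fun q => (fr.frameCoord (pr p) q).inverse) (s (pr p)) :=
    (fr.contMDiffAt_frameCoord_inverse (by rwa [hsp])).continuousAt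
  have hinv' : ContinuousAt (fun z : TangentBundle 𝓘(ℝ, F) N =>
      (fr.frameCoord (pr p) (s z.proj)).inverse) (fr.total (p, a)) :=
    ContinuousAt.comp (f := fun z : TangentBundle 𝓘(ℝ, F) N => s z.proj)
      (g := fun q => (fr.frameCoord (pr p) q).inverse) hinv hs1
  have he : ContinuousAt e (fr.total (p, a)) :=
    e.continuousOn.continuousAt (e.open_source.mem_nhds ((Bundle.Trivialization.mem_source _).2 hmem))
  have hτ : ContinuousAt τ (fr.total (p, a)) := hs1.prodMk (hinv'.clm_apply he.snd)
  have hτ0 : τ (fr.total (p, a)) = (p, a) := by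
    refine Prod.ext hsp ?_
    change (fr.frameCoord (pr p) (s (pr p))).inverse (e ⟨pr p, fr.frame p a⟩).2 = a
    rw [hsp, ← trivCoord_apply hmem]
    exact (fr.isInvertible_frameCoord hmem).inverse_apply_self a
  have hτe : ∀ᶠ z in 𝓝 (fr.total (p, a)), fr.total (τ z) = z := by
    filter_upwards [hproj.eventually hs', hproj.eventually ((isOpen_trivSet (pr p)).mem_nhds hmem)]
      with z h1 h2
    obtain ⟨x, v⟩ := z
    change pr (s x) = x at h1
    change x ∈ trivSet (F := F) (pr p) at h2
    have h3 : fr.frame (s x) ((fr.frameCoord (pr p) (s x)).inverse (e ⟨x, v⟩).2) = v := by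
      have h4 : (e ⟨x, v⟩).2 = trivCoord (F := F) (pr p) x v := (trivCoord_apply h2 v).symm
      rw [h4]
      refine (isInvertible_trivCoord h2).injective ?_
      have h5 := (fr.isInvertible_frameCoord (p := s x) (by rwa [h1])).self_apply_inverse
        (trivCoord (F := F) (pr p) x v)
      unfold frameCoord at h5 ⊢
      rw [h1] at h5 ⊢
      exact h5
    have h6 : ∀ y (w : F), y = x → w = v → (⟨y, w⟩ : TangentBundle 𝓘(ℝ, F) N) = ⟨x, v⟩ := by
      rintro _ _ rfl rfl; rfl
    exact h6 _ _ h1 h3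
  intro S hS
  have h7 : ∀ᶠ z in 𝓝 (fr.total (p, a)), fr.total (τ z) ∈ S := by
    have h8 : Filter.Tendsto τ (𝓝 (fr.total (p, a))) (𝓝 (p, a)) := by
      have h9 : Filter.Tendsto τ (𝓝 (fr.total (p, a))) (𝓝 (τ (fr.total (p, a)))) := hτ
      rwa [hτ0] at h9
    exact h8.eventually hS
  filter_upwards [h7, hτe] with z h1 h2
  rwa [h2] at h1

end HorizontalFraming

end Total

/-! ### Charts in which `P × A → T N` is a linear projection. -/

section TotalSubmersion

variable {E F A K : Type*} [NormedAddCommGroup E] [NormedSpace ℝ E]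
    [NormedAddCommGroup F] [NormedSpace ℝ F] [NormedAddCommGroup A] [NormedSpace ℝ A]
    [NormedAddCommGroup K] [NormedSpace ℝ K]
    {P : Type*} [TopologicalSpace P] [ChartedSpace E P] [IsManifold 𝓘(ℝ, E) ∞ P]
    {N : Type*} [TopologicalSpace N] [ChartedSpace F N] [IsManifold 𝓘(ℝ, F) ∞ N] {pr : P → N}

namespace HorizontalFraming

variable (fr : HorizontalFraming E F A pr) [FiniteDimensional ℝ A]

omit [FiniteDimensional ℝ A] in
lemma isOpen_preimage_trivSet (fr : HorizontalFraming E F A pr) (x₀ : N) :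
    IsOpen {q : P | pr q ∈ trivSet (F := F) x₀} :=
  (isOpen_trivSet x₀).preimage fr.contMDiff_proj.continuous

lemma contMDiffOn_frameCoord_apply (x₀ : N) :
    ContMDiffOn (𝓘(ℝ, E).prod 𝓘(ℝ, A)) (𝓘(ℝ, E).prod 𝓘(ℝ, F)) ∞
      (fun q : P × A => (q.1, fr.frameCoord x₀ q.1 q.2)) {q | pr q.1 ∈ trivSet (F := F) x₀} := by
  intro q hq
  have h1 : ContMDiffAt (𝓘(ℝ, E).prod 𝓘(ℝ, A)) 𝓘(ℝ, A →L[ℝ] F) ∞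
      (fun q : P × A => fr.frameCoord x₀ q.1) q :=
    ContMDiffAt.comp q (fr.contMDiffAt_frameCoord hq) contMDiffAt_fst
  exact (contMDiffAt_fst.prodMk (h1.clm_apply contMDiffAt_snd)).contMDiffWithinAt

lemma contMDiffOn_frameCoord_inverse_apply (x₀ : N) :
    ContMDiffOn (𝓘(ℝ, E).prod 𝓘(ℝ, F)) (𝓘(ℝ, E).prod 𝓘(ℝ, A)) ∞
      (fun q : P × F => (q.1, (fr.frameCoord x₀ q.1).inverse q.2))
      {q | pr q.1 ∈ trivSet (F := F) x₀} := by
  intro q hq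
  have h1 : ContMDiffAt (𝓘(ℝ, E).prod 𝓘(ℝ, F)) 𝓘(ℝ, F →L[ℝ] A) ∞
      (fun q : P × F => (fr.frameCoord x₀ q.1).inverse) q :=
    ContMDiffAt.comp q (fr.contMDiffAt_frameCoord_inverse hq) contMDiffAt_fst
  exact (contMDiffAt_fst.prodMk (h1.clm_apply contMDiffAt_snd)).contMDiffWithinAt

/-- The map `(p, a) ↦ (p, v)`, where `v` is the coordinate of the frame vector `frame p a` in the
trivialization of `T N` at `x₀`. -/
def totalChart (x₀ : N) : OpenPartialHomeomorph (P × A) (P × F) where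
  toFun q := (q.1, fr.frameCoord x₀ q.1 q.2)
  invFun q := (q.1, (fr.frameCoord x₀ q.1).inverse q.2)
  source := {q | pr q.1 ∈ trivSet (F := F) x₀}
  target := {q | pr q.1 ∈ trivSet (F := F) x₀}
  map_source' _ hq := hq
  map_target' _ hq := hq
  left_inv' q hq := Prod.ext rfl ((fr.isInvertible_frameCoord hq).inverse_apply_self q.2)
  right_inv' q hq := Prod.ext rfl ((fr.isInvertible_frameCoord hq).self_apply_inverse q.2)
  open_source := (fr.isOpen_preimage_trivSet x₀).preimage continuous_fst
  open_target := (fr.isOpen_preimage_trivSet x₀).preimage continuous_fst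
  continuousOn_toFun := (fr.contMDiffOn_frameCoord_apply x₀).continuousOn
  continuousOn_invFun := (fr.contMDiffOn_frameCoord_inverse_apply x₀).continuousOn

/-- The chart of `P × A` given by a chart `φ` of `P`, the trivialization of `T N` at `x₀` and a
linear isomorphism `F ≃ A`. -/
def totalDomChart (x₀ : N) (φ : OpenPartialHomeomorph P E) (lam : F ≃L[ℝ] A) :
    OpenPartialHomeomorph (P × A) (ModelProd E A) :=
  fr.totalChart x₀ ≫ₕ φ.prod lam.toHomeomorph.toOpenPartialHomeomorph

lemma totalDomChart_mem_maximalAtlas (x₀ : N) {φ : OpenPartialHomeomorph P E}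
    (hφ : φ ∈ IsManifold.maximalAtlas 𝓘(ℝ, E) ∞ P) (lam : F ≃L[ℝ] A) :
    fr.totalDomChart x₀ φ lam ∈ IsManifold.maximalAtlas (𝓘(ℝ, E).prod 𝓘(ℝ, A)) ∞ (P × A) := by
  refine OpenPartialHomeomorph.mem_maximalAtlas_of_contMDiffOn _ ?_ ?_
  · have h1 : ContMDiffOn (𝓘(ℝ, E).prod 𝓘(ℝ, F)) 𝓘(ℝ, E × A) ∞
        (fun q : P × F => (φ q.1, lam q.2)) {q | q.1 ∈ φ.source} :=
      ((contMDiffOn_of_mem_maximalAtlas hφ).comp contMDiffOn_fst fun _ hq => hq).prodMk_space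
        ((lam.contDiff (n := ∞)).contMDiff.comp contMDiff_snd).contMDiffOn
    have h2 := h1.comp ((fr.contMDiffOn_frameCoord_apply x₀).mono
      (t := (fr.totalDomChart x₀ φ lam).source) fun q hq => hq.1) fun q hq => hq.2.1
    rw [modelWithCornersSelf_prod] at h2
    exact h2
  · have h1 : ContMDiffOn 𝓘(ℝ, E × A) (𝓘(ℝ, E).prod 𝓘(ℝ, F)) ∞
        (fun y : E × A => (φ.symm y.1, lam.symm y.2)) {y | y.1 ∈ φ.target} :=
      ((contMDiffOn_symm_of_mem_maximalAtlas hφ).comp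
        contDiff_fst.contMDiff.contMDiffOn fun _ hq => hq).prodMk
        ((lam.symm.contDiff (n := ∞)).contMDiff.comp contDiff_snd.contMDiff).contMDiffOn
    let T : Set (E × A) := (fr.totalDomChart x₀ φ lam).target
    have h2 := (fr.contMDiffOn_frameCoord_inverse_apply x₀).comp (h1.mono (t := T) fun y hy => hy.1.1) fun y hy => hy.2
    rw [modelWithCornersSelf_prod] at h2
    exact h2

end HorizontalFraming

/-- The chart of `T N` given by a chart of `N` and the trivialization at `x₀`. -/
def tangentChart (x₀ : N) (ψ : OpenPartialHomeomorph N F) :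
    OpenPartialHomeomorph (TangentBundle 𝓘(ℝ, F) N) (ModelProd F F) :=
  (trivializationAt F (TangentSpace 𝓘(ℝ, F) : N → Type _) x₀).toOpenPartialHomeomorph ≫ₕ
    ψ.prod (OpenPartialHomeomorph.refl F)

lemma tangentChart_mem_maximalAtlas (x₀ : N) {ψ : OpenPartialHomeomorph N F}
    (hψ : ψ ∈ IsManifold.maximalAtlas 𝓘(ℝ, F) ∞ N) :
    tangentChart x₀ ψ ∈ IsManifold.maximalAtlas 𝓘(ℝ, F).tangent ∞ (TangentBundle 𝓘(ℝ, F) N) := by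
  have he := (trivializationAt F (TangentSpace 𝓘(ℝ, F) : N → Type _) x₀).contMDiffOn
    (IB := 𝓘(ℝ, F)) (n := ∞)
  have he' := (trivializationAt F (TangentSpace 𝓘(ℝ, F) : N → Type _) x₀).contMDiffOn_symm
    (IB := 𝓘(ℝ, F)) (n := ∞)
  refine OpenPartialHomeomorph.mem_maximalAtlas_of_contMDiffOn _ ?_ ?_
  · have h1 : ContMDiffOn (𝓘(ℝ, F).prod 𝓘(ℝ, F)) 𝓘(ℝ, F × F) ∞
        (fun q : N × F => (ψ q.1, q.2)) {q | q.1 ∈ ψ.source} :=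
      ((contMDiffOn_of_mem_maximalAtlas hψ).comp contMDiffOn_fst fun _ hq => hq).prodMk_space
        contMDiff_snd.contMDiffOn
    have h2 := h1.comp (he.mono (t := (tangentChart x₀ ψ).source) fun q hq => hq.1)
      fun q hq => hq.2.1
    rw [modelWithCornersSelf_prod] at h2
    exact h2
  · have h1 : ContMDiffOn 𝓘(ℝ, F × F) (𝓘(ℝ, F).prod 𝓘(ℝ, F)) ∞
        (fun y : F × F => (ψ.symm y.1, y.2)) {y | y.1 ∈ ψ.target} :=
      ((contMDiffOn_symm_of_mem_maximalAtlas hψ).comp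
        contDiff_fst.contMDiff.contMDiffOn fun _ hq => hq).prodMk
        contDiff_snd.contMDiff.contMDiffOn
    let T : Set (F × F) := (tangentChart x₀ ψ).target
    have h2 := he'.comp (h1.mono (t := T) fun y hy => hy.1.1)
      fun y hy => hy.2
    rw [modelWithCornersSelf_prod] at h2
    exact h2

/-- The rearrangement `E × A ≃ (F × A) × K` of an isomorphism `E ≃ F × K`. -/
def prodRearrange (L : E ≃L[ℝ] F × K) : (E × A) ≃L[ℝ] (F × A) × K where
  toFun y := (((L y.1).1, y.2), (L y.1).2)
  invFun z := (L.symm (z.1.1, z.2), z.1.2)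
  map_add' y z := by simp
  map_smul' r y := by simp
  left_inv y := by simp
  right_inv z := by simp
  continuous_toFun := by fun_prop
  continuous_invFun := by fun_prop

instance : (𝓘(ℝ, F).tangent : ModelWithCorners ℝ (F × F) (ModelProd F F)).Boundaryless :=
  inferInstanceAs ((𝓘(ℝ, F).prod 𝓘(ℝ, F)).Boundaryless)

/-- The isomorphism of model spaces induced by an isomorphism `F ≃ A`. -/
def modelEquiv (lam : F ≃L[ℝ] A) : (F × F) ≃L[ℝ] F × A :=
  (ContinuousLinearEquiv.refl ℝ F).prodCongr lam

/-- The map `P × A → T N` of a framing of a submersion is a submersion, also when `T N` is replaced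
by a homeomorphic space with the transported manifold structure. -/
lemma HorizontalFraming.isSubmersionOfComplement_of_total [FiniteDimensional ℝ A]
    (fr : HorizontalFraming E F A pr)
    (hpr : Manifold.IsSubmersionOfComplement K 𝓘(ℝ, E) 𝓘(ℝ, F) ∞ pr) (lam : F ≃L[ℝ] A)
    {X : Type*} [TopologicalSpace X] (Φ : X ≃ₜ TangentBundle 𝓘(ℝ, F) N) {m : P × A → X}
    (hm : ∀ q, Φ (m q) = fr.total q) :
    letI := transportChartedSpace 𝓘(ℝ, F).tangent (modelEquiv lam) Φ
    Manifold.IsSubmersionOfComplement K (𝓘(ℝ, E).prod 𝓘(ℝ, A)) 𝓘(ℝ, F × A) ∞ m := by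
  let := transportChartedSpace 𝓘(ℝ, F).tangent (modelEquiv lam) Φ
  rintro ⟨p, a⟩
  obtain ⟨φ, ψ, L, hp, hprp, hmaps, hL, hφ, hψ⟩ := exists_charts_of_isSubmersionAt (hpr p)
  have hmc : Continuous m := by
    have h1 : m = fun q => Φ.symm (fr.total q) := funext fun q => by rw [← hm, Φ.symm_apply_apply]
    rw [h1]
    exact Φ.symm.continuous.comp fr.contMDiff_total.continuous
  have hmem := mem_trivSet (F := F) (pr p)
  -- Using the coordinate `v` of the frame vector in place of `a` makes the map the identity on
  -- fibre coordinates, so that only the projection `E ≃ F × K → F` of the base remains. The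
  -- complement is therefore the same `K` as for `pr`.
  refine Manifold.IsSubmersionAtOfComplement.mk_of_continuousAt hmc.continuousAt
    (prodRearrange L) (fr.totalDomChart (pr p) φ lam)
    (transportChart 𝓘(ℝ, F).tangent (modelEquiv lam) Φ (tangentChart (pr p) ψ))
    ⟨hmem, hp, trivial⟩ ?_ (fr.totalDomChart_mem_maximalAtlas _ hφ lam)
    (transportChart_mem_maximalAtlas _ _ _ (tangentChart_mem_maximalAtlas _ hψ)) ?_
  · rw [transportChart_source]
    change Φ (m (p, a)) ∈ (tangentChart (pr p) ψ).source
    rw [hm]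
    exact ⟨(Bundle.Trivialization.mem_source _).2 hmem, hprp, trivial⟩
  · rintro ⟨y, c⟩ hy
    rw [OpenPartialHomeomorph.extend_target] at hy
    obtain ⟨⟨hy1, -⟩, hy2⟩ := hy.1
    change y ∈ φ.target at hy1
    change pr (φ.symm y) ∈ trivSet (F := F) (pr p) at hy2
    -- The `A`-component of the inverse domain chart at `(y, c)`.
    let b : A := (fr.frameCoord (pr p) (φ.symm y)).inverse (lam.symm c)
    have hb : fr.frameCoord (pr p) (φ.symm y) b = lam.symm c :=
      (fr.isInvertible_frameCoord hy2).self_apply_inverse _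
    have h1 : Φ (m (φ.symm y, b)) = fr.total (φ.symm y, b) := hm _
    have h2 : tangentChart (pr p) ψ (fr.total (φ.symm y, b)) =
        (ψ (pr (φ.symm y)), trivCoord (F := F) (pr p) (pr (φ.symm y)) (fr.frame (φ.symm y) b)) := by
      refine Prod.ext ?_ (trivCoord_apply hy2 _).symm
      have h3 : (trivializationAt F (TangentSpace 𝓘(ℝ, F) : N → Type _) (pr p)
          (fr.total (φ.symm y, b))).1 = pr (φ.symm y) :=
        Bundle.Trivialization.coe_fst _ ((Bundle.Trivialization.mem_source _).2 hy2)
      exact congrArg ψ h3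
    have h3 : trivCoord (F := F) (pr p) (pr (φ.symm y)) (fr.frame (φ.symm y) b) = lam.symm c := hb
    change modelEquiv lam (tangentChart (pr p) ψ (Φ (m (φ.symm y, b)))) = ((L y).1, c)
    rw [h1, h2, h3, hL _ (φ.map_target hy1), φ.right_inv hy1]
    exact Prod.ext rfl (lam.apply_symm_apply c)

end TotalSubmersion

/-! ### The associated bundle as the tangent bundle of `G/H`. -/

section Associated

variable {E : Type*} [NormedAddCommGroup E] [NormedSpace ℝ E] [FiniteDimensional ℝ E]
  {G : Type*} [TopologicalSpace G] [ChartedSpace E G] [Group G] [LieGroup 𝓘(ℝ, E) ∞ G]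
  {H : Subgroup G} {M : InvariantComplement (E := E) H}
  {F K : Type*} [NormedAddCommGroup F] [NormedSpace ℝ F] [NormedAddCommGroup K] [NormedSpace ℝ K]
  [ChartedSpace F (G ⧸ H)]
  (hπ : Manifold.IsSubmersionOfComplement K 𝓘(ℝ, E) 𝓘(ℝ, F) ∞ (fun g : G => (g : G ⧸ H)))

/-- Right multiplication by `h` does not change the projection, and it turns the left-invariant
direction `X` into `Ad h⁻¹ X`. -/
lemma frame_mul_right (M : InvariantComplement (E := E) H) (g : G) (h : H) (X : M.normed) :
    (quotientFraming hπ M).frame (g * h) (M.ad h⁻¹ X) = (quotientFraming hπ M).frame g X := by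
  have h1 : mfderivModel E F (fun g : G => (g : G ⧸ H)) g =
      (mfderivModel E F (fun g : G => (g : G ⧸ H)) (g * h)).comp
        (mfderivModel E E (fun x : G => x * h) g) := by
    rw [← mfderivModel_comp g ((quotientFraming hπ M).mdifferentiableAt_proj _)
      (mdifferentiableAt_mul_right _ g)]
    congr 1
    funext x
    exact QuotientGroup.eq.2 (by simp)
  change mfderivModel E F (fun g : G => (g : G ⧸ H)) (g * h)
    (leftTranslation E (g * h) (adModel (h : G)⁻¹ X)) =
    mfderivModel E F (fun g : G => (g : G ⧸ H)) g (leftTranslation E g X)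
  rw [h1, ← mfderivModel_mul_right]
  rfl

/-- Equal base points give `g' = g h` with `h ∈ H`. The vectors can then be compared in the frame at
`g'`, and its injectivity forces `Y = Ad h⁻¹ X`. -/
lemma total_eq_iff (p q : G × M.normed) :
    (quotientFraming hπ M).total p = (quotientFraming hπ M).total q ↔
      AssocBundle.mk M p = AssocBundle.mk M q := by
  have hmk : ∀ (x y : G ⧸ H) (v w : F), x = y → v = w →
      (⟨x, v⟩ : TangentBundle 𝓘(ℝ, F) (G ⧸ H)) = ⟨y, w⟩ := by
    rintro _ _ _ _ rfl rfl; rfl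
  obtain ⟨g, X⟩ := p
  obtain ⟨g', Y⟩ := q
  rw [AssocBundle.mk_eq_iff]
  constructor
  · intro h
    obtain ⟨h1, h2⟩ := Bundle.TotalSpace.mk.inj h
    have h3 : (quotientFraming hπ M).frame g X = (quotientFraming hπ M).frame g' Y := eq_of_heq h2
    have hmem := QuotientGroup.eq.1 h1
    have hg : g' = g * (⟨_, hmem⟩ : H) := by simp
    refine ⟨⟨_, hmem⟩, hg, ?_⟩
    refine ((quotientFraming hπ M).isInvertible g').injective ?_
    rw [← h3, ← frame_mul_right hπ M g ⟨_, hmem⟩ X, ← hg]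
  · rintro ⟨h, rfl, rfl⟩
    exact hmk _ _ _ _ (QuotientGroup.eq.2 (by simp)) (frame_mul_right hπ M g h X).symm

variable [IsManifold 𝓘(ℝ, F) ∞ (G ⧸ H)]

/-- The homeomorphism `G ×_{Ad_H} M ≃ T(G/H)`, `[g, X] ↦ π_* (L_g)_* X`. -/
def assocHomeomorph (M : InvariantComplement (E := E) H) :
    AssocBundle M ≃ₜ TangentBundle 𝓘(ℝ, F) (G ⧸ H) :=
  (Equiv.ofBijective (Quotient.lift (s := assocSetoid M) (quotientFraming hπ M).total
      fun p q hpq => (total_eq_iff hπ p q).2 (Quotient.sound hpq)) (by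
    constructor
    · intro p q hpq
      induction p using Quotient.inductionOn
      induction q using Quotient.inductionOn
      exact (total_eq_iff hπ _ _).1 hpq
    · intro z
      obtain ⟨p, hp⟩ := (quotientFraming hπ M).surjective_total z
      exact ⟨AssocBundle.mk M p, hp⟩)).toHomeomorphOfContinuousOpen
    ((quotientFraming hπ M).contMDiff_total.continuous.quotient_lift _) (by
      intro U hU
      have h1 := (quotientFraming hπ M).isOpenMap_total _
        (hU.preimage (continuous_quot_mk : Continuous (AssocBundle.mk M)))
      convert h1 using 1
      ext z
      constructor
      · rintro ⟨p, hp, rfl⟩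
        induction p using Quotient.inductionOn with
        | h p => exact ⟨p, hp, rfl⟩
      · rintro ⟨p, hp, rfl⟩
        exact ⟨AssocBundle.mk M p, hp, rfl⟩)

lemma assocHomeomorph_mk (p : G × M.normed) :
    assocHomeomorph hπ M (AssocBundle.mk M p) = (quotientFraming hπ M).total p := rfl

/-- The structure is pulled back from `T(G/H)`, so the diffeomorphism holds by construction. The
content lies in the submersion property and in the agreement of the two linear structures on the
fibres. -/
lemma exists_manifold_assocBundle
    (hπ : Manifold.IsSubmersionOfComplement K 𝓘(ℝ, E) 𝓘(ℝ, F) ∞ (fun g : G => (g : G ⧸ H)))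
    (M : InvariantComplement (E := E) H) :
    ∃ _ : ChartedSpace (F × M.normed) (AssocBundle M),
      IsManifold 𝓘(ℝ, F × M.normed) ∞ (AssocBundle M) ∧
      Manifold.IsSubmersion (𝓘(ℝ, E).prod 𝓘(ℝ, M.normed)) 𝓘(ℝ, F × M.normed) ∞
        (AssocBundle.mk M) ∧
      ∃ Φ : AssocBundle M ≃ₘ^∞⟮𝓘(ℝ, F × M.normed), 𝓘(ℝ, F).tangent⟯
          TangentBundle 𝓘(ℝ, F) (G ⧸ H),
        (∀ (g : G) (X : M.normed),
          Φ (AssocBundle.mk M (g, X)) = ⟨(g : G ⧸ H), toTangent F M g X⟩) ∧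
        ∀ x : G ⧸ H, ∃ ℓ : AssocBundle.Fiber M x ≃ₗ[ℝ] TangentSpace 𝓘(ℝ, F) x,
          ∀ p : AssocBundle.Fiber M x, Φ p.1 = ⟨x, ℓ p⟩ := by
  -- The frame at `1` identifies `M` with `F`; it serves only to replace the model `F × F` of the
  -- tangent bundle by `F × M`.
  obtain ⟨u, -⟩ := (quotientFraming hπ M).isInvertible 1
  let := transportChartedSpace 𝓘(ℝ, F).tangent (modelEquiv u.symm) (assocHomeomorph hπ M)
  refine ⟨this, isManifold_transport 𝓘(ℝ, F).tangent (modelEquiv u.symm) (assocHomeomorph hπ M),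
    ((quotientFraming hπ M).isSubmersionOfComplement_of_total hπ u.symm (assocHomeomorph hπ M)
      (assocHomeomorph_mk hπ)).isSubmersion,
    { toEquiv := (assocHomeomorph hπ M).toEquiv
      contMDiff_toFun := contMDiff_transport _ _ _
      contMDiff_invFun := contMDiff_transport_symm _ _ _ }, fun g X => rfl, fun x => ?_⟩
  obtain ⟨g, rfl⟩ := Quotient.mk_surjective x
  obtain ⟨v, hv⟩ := (quotientFraming hπ M).isInvertible g
  let v' : M.normed ≃ₗ[ℝ] TangentSpace 𝓘(ℝ, F) (g : G ⧸ H) := v.toLinearEquiv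
  -- Over `gH` both fibres are linearly parametrized by `M`, through `X ↦ [g, X]` and through the
  -- frame at `g`.
  refine ⟨(AssocBundle.fiberLinearEquiv g rfl).symm.trans v', fun p => ?_⟩
  obtain ⟨X, rfl⟩ := (AssocBundle.fiberLinearEquiv (M := M) g rfl).surjective p
  rw [LinearEquiv.trans_apply, LinearEquiv.symm_apply_apply]
  have h1 : v X = (quotientFraming hπ M).frame g X := congrArg (fun L : M.normed →L[ℝ] F => L X) hv
  exact congrArg (fun w : F => (⟨(g : G ⧸ H), w⟩ : TangentBundle 𝓘(ℝ, F) (G ⧸ H))) h1.symm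

end Associated

end Homogeneous

end

open Homogeneous in
theorem mainTheorem11
    {E : Type*} [NormedAddCommGroup E] [NormedSpace ℝ E] [FiniteDimensional ℝ E]
    {G : Type*} [TopologicalSpace G] [ChartedSpace E G] [Group G] [LieGroup 𝓘(ℝ, E) ∞ G]
    (H : Subgroup G) (hH : IsClosed (H : Set G)) (M : InvariantComplement (E := E) H)
    {F : Type*} [NormedAddCommGroup F] [NormedSpace ℝ F] [FiniteDimensional ℝ F]
    [ChartedSpace F (G ⧸ H)] [IsManifold 𝓘(ℝ, F) ∞ (G ⧸ H)]
    (hπ : Manifold.IsSubmersion 𝓘(ℝ, E) 𝓘(ℝ, F) ∞ (fun g : G => (g : G ⧸ H))) :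
    (∃ _ : ChartedSpace (F × M.normed) (AssocBundle M),
      IsManifold 𝓘(ℝ, F × M.normed) ∞ (AssocBundle M) ∧
      Manifold.IsSubmersion (𝓘(ℝ, E).prod 𝓘(ℝ, M.normed)) 𝓘(ℝ, F × M.normed) ∞
        (AssocBundle.mk M) ∧
      ∃ Φ : AssocBundle M ≃ₘ^∞⟮𝓘(ℝ, F × M.normed), 𝓘(ℝ, F).tangent⟯
          TangentBundle 𝓘(ℝ, F) (G ⧸ H),
        (∀ (g : G) (X : M.normed),
          Φ (AssocBundle.mk M (g, X)) = ⟨(g : G ⧸ H), toTangent F M g X⟩) ∧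
        ∀ x : G ⧸ H, ∃ ℓ : AssocBundle.Fiber M x ≃ₗ[ℝ] TangentSpace 𝓘(ℝ, F) x,
          ∀ p : AssocBundle.Fiber M x, Φ p.1 = ⟨x, ℓ p⟩) ∧
    IsPrincipalConnection F H (horizontal M) ∧
    (∃ cov : CovariantDerivative 𝓘(ℝ, F) F (TangentSpace 𝓘(ℝ, F) : G ⧸ H → Type _),
      CovariantDerivative.ContMDiffCovariantDerivative cov ∞ ∧
      IsInducedConnection M (horizontal M) cov ∧
      ∀ cov' : CovariantDerivative 𝓘(ℝ, F) F (TangentSpace 𝓘(ℝ, F) : G ⧸ H → Type _),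
        IsInducedConnection M (horizontal M) cov' →
        ∀ (σ : ∀ x : G ⧸ H, TangentSpace 𝓘(ℝ, F) x) (x : G ⧸ H),
          MDifferentiableAt 𝓘(ℝ, F) (𝓘(ℝ, F).prod 𝓘(ℝ, F))
            (fun y => (⟨y, σ y⟩ : TangentBundle 𝓘(ℝ, F) (G ⧸ H))) x → cov' σ x = cov σ x) ∧
    (∃ covG : CovariantDerivative 𝓘(ℝ, E) E (TangentSpace 𝓘(ℝ, E) : G → Type _),
      CovariantDerivative.ContMDiffCovariantDerivative covG ∞ ∧
      IsCanonicalLeftInvariant covG) ∧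
    (∀ cov : CovariantDerivative 𝓘(ℝ, F) F (TangentSpace 𝓘(ℝ, F) : G ⧸ H → Type _),
      IsInducedConnection M (horizontal M) cov →
      ∀ covG : CovariantDerivative 𝓘(ℝ, E) E (TangentSpace 𝓘(ℝ, E) : G → Type _),
      IsCanonicalLeftInvariant covG →
      ∀ J : Set ℝ, IsOpen J → J.OrdConnected → ∀ c : ℝ → G ⧸ H,
        (IsGeodesicOn cov c J ↔
          ∃ X : M.normed, ∃ γ : ℝ → G,
            IsMIntegralCurveOn γ
              (mulInvariantVectorField (M.incl X) : ∀ g : G, TangentSpace 𝓘(ℝ, E) g) J ∧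
            (∀ t ∈ J, velocity γ t ∈ horizontal M (γ t)) ∧
            ∀ t ∈ J, (γ t : G ⧸ H) = c t) ∧
        ∀ t₀ ∈ J, (IsGeodesicOn cov c J ↔
          ∃ γ : ℝ → G, IsGeodesicOn covG γ J ∧ velocity γ t₀ ∈ horizontal M (γ t₀) ∧
            ∀ t ∈ J, (γ t : G ⧸ H) = c t)) := by
  obtain ⟨K, _, _, hK⟩ := hπ
  have : CompleteSpace E := FiniteDimensional.complete ℝ E
  refine ⟨exists_manifold_assocBundle hK M, isPrincipalConnection_horizontal hK M,
    ⟨(quotientFraming hK M).cov, (quotientFraming hK M).contMDiffCovariantDerivative_cov,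
      isInducedConnection_iff.2 (quotientFraming hK M).isInduced_cov, ?_⟩,
    ⟨leftInvariantFraming.cov, leftInvariantFraming.contMDiffCovariantDerivative_cov,
      isCanonicalLeftInvariant_iff.2 leftInvariantFraming.isInduced_cov⟩, ?_⟩
  · intro cov' h' σ x hσ
    exact (isInducedConnection_iff.1 h').eq (quotientFraming hK M).isInduced_cov hσ
  · intro cov hcov covG hcovG J hJ hJ' c
    refine ⟨?_, fun t₀ ht₀ => isGeodesicOn_iff_exists_isGeodesicOn hK hcov hcovG hJ hJ' ht₀⟩
    rw [isGeodesicOn_iff_exists_integralCurve hK hcov hJ hJ']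
    constructor
    · rintro ⟨X, γ, hγ, hcγ⟩
      refine ⟨X, γ, fun t ht => (hγ t ht).hasMFDerivWithinAt, fun t ht => ?_, hcγ⟩
      have h1 := (leftTranslation_mem_horizontal_iff (M := M) (γ t) (X : E)).2 X.2
      rw [← (hγ t ht).velocity_eq] at h1
      exact h1
    · rintro ⟨X, γ, hγ, -, hcγ⟩
      -- On the open set `J` derivatives within `J` are full derivatives. The horizontality
      -- condition carries no information here, since `X ∈ M`.
      exact ⟨X, γ, fun t ht => (hγ t ht).hasMFDerivAt (hJ.mem_nhds ht), hcγ⟩
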